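/- Let $\mathbb N_0=\{0,1,2,\dots\}$ and let $H_0$ be the discrete Laguerre operator in the complex Hilbert space $\ell^2(\mathbb N_0)$, that is, $H_0u=\tau u$ on the maximal domain $\{u\in\ell^2(\mathbb N_0):\tau u\in\ell^2(\mathbb N_0)\}$, where $$(\tau u)_0=u_0+u_1,\qquad (\tau u)_n=n\,u_{n-1}+(2n+1)\,u_n+(n+1)\,u_{n+1}\quad(n\ge 1).$$ Then there is exactly one strongly continuous one-parameter unitary group $(\mathrm e^{-\mathrm itH_0})_{t\in\mathbb R}$ on $\ell^2(\mathbb N_0)$ whose infinitesimal generator is $-\mathrm iH_0$ (with the same domain). Write $\mathrm e^{-\mathrm itH_0}(n,m)=\langle\delta_n,\mathrm e^{-\mathrm itH_0}\delta_m\rangle$ for its kernel with respect to the standard orthonormal basis $(\delta_n)_{n\in\mathbb N_0}$. There is a constant $C\le 2\sqrt[4]{42}$ such that $$\bigl|\mathrm e^{-\mathrm itH_0}(n,m)\bigr|\le\frac{C}{t^{1/2}\,(n+m+1)^{1/4}}$$ for all $n,m\in\mathbb N_0$ and all $t>0$. -/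

import Mathlib

open scoped InnerProductSpace

noncomputable section

namespace DiscreteLaguerre

/-- The Hilbert space `ℓ²(ℕ₀)` of square summable complex sequences. -/
abbrev EllTwo : Type := lp (fun _ : ℕ => ℂ) 2

/-- The difference expression `τ` of the Jacobi matrix with diagonal entries `2n+1` and
off-diagonal entries `h_{n,n+1} = h_{n+1,n} = n+1`. -/
def tau (u : ℕ → ℂ) : ℕ → ℂ
  | 0 => u 0 + u 1
  | n + 1 => ((n : ℂ) + 1) * u n + (2 * ((n : ℂ) + 1) + 1) * u (n + 1)
      + (((n : ℂ) + 1) + 1) * u (n + 2)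

theorem tau_add (u v : ℕ → ℂ) : tau (u + v) = tau u + tau v := by
  funext n
  cases n <;> simp only [tau, Pi.add_apply] <;> ring

theorem tau_smul (c : ℂ) (u : ℕ → ℂ) : tau (c • u) = c • tau u := by
  funext n
  cases n <;> simp only [tau, Pi.smul_apply, smul_eq_mul] <;> ring

theorem tau_zero : tau 0 = 0 := by
  funext n
  cases n <;> simp [tau]

/-- The maximal domain `{u ∈ ℓ² : τ u ∈ ℓ²}`. -/
def maxDomain : Submodule ℂ EllTwo where
  carrier := {u | Memℓp (tau (u : ℕ → ℂ)) 2}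
  zero_mem' := by
    simp only [Set.mem_ofPred_eq, lp.coeFn_zero, tau_zero]
    exact zero_memℓp
  add_mem' := by
    intro u v hu hv
    simp only [Set.mem_ofPred_eq, lp.coeFn_add, tau_add] at *
    exact hu.add hv
  smul_mem' := by
    intro c u hu
    simp only [Set.mem_ofPred_eq, lp.coeFn_smul, tau_smul] at *
    exact hu.const_smul c

/-- The discrete Laguerre operator `H₀ u = τ u` on its maximal domain. -/
def H0 : EllTwo →ₗ.[ℂ] EllTwo where
  domain := maxDomain
  toFun :=
    { toFun := fun u => ⟨tau (u : EllTwo), u.2⟩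
      map_add' := fun u v => by
        ext1
        exact tau_add _ _
      map_smul' := fun c u => by
        ext1
        exact tau_smul _ _ }

/-- `U t = e^{-itA}` for all real `t`: the family `U` is the strongly continuous one-parameter
unitary group whose infinitesimal generator is exactly `-iA`, domain included. -/
structure IsEvolutionGroup {E : Type*} [NormedAddCommGroup E] [InnerProductSpace ℂ E]
    [CompleteSpace E] (A : E →ₗ.[ℂ] E) (U : ℝ → E →L[ℂ] E) : Prop where
  map_zero : U 0 = 1
  map_add : ∀ s t, U (s + t) = U s * U t
  unitary : ∀ t, U t ∈ unitary (E →L[ℂ] E)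
  continuous : ∀ u, Continuous fun t => U t u
  hasDerivAt : ∀ u : A.domain, HasDerivAt (fun t => U t u) (-Complex.I • A u) 0
  mem_domain : ∀ u, DifferentiableAt ℝ (fun t => U t u) 0 → u ∈ A.domain

/-- The unit vector `δ_n` of `ℓ²(ℕ₀)`. -/
def delta (n : ℕ) : EllTwo := lp.single 2 n 1

/-- The kernel (matrix entry) `B(n, m) = ⟨δ_n, B δ_m⟩` of a bounded operator on `ℓ²(ℕ₀)`. -/
def kernel (B : EllTwo →L[ℂ] EllTwo) (n m : ℕ) : ℂ := ⟪delta n, B (delta m)⟫_ℂ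

end DiscreteLaguerre

end

open scoped InnerProductSpace

noncomputable section

namespace DiscreteLaguerre

open Filter Topology ComplexConjugate

/-! ### Symmetry of the maximal operator -/

/-! The boundary term in Green's formula for `τ` is `n + 1` times a summable Casoratian. It
converges, and its limit must be zero because the harmonic series diverges, so `H₀` is symmetric on
its maximal domain and inner products of strong solutions of `i c' = H₀ c` are conserved. Hence
strong solutions starting at every `δ_m` are enough for existence and uniqueness of the group: they
form an orthonormal family at each time, so they define isometries, and the group law, the generator
and its domain are read off from matrix entries (`existsUnique_isEvolutionGroup`).

These solutions are explicit. On generating functions `τ` becomes `f ↦ (1+z)² f' + (1+z) f`, so the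
equation is a transport equation. In the coordinate `w = 1/(1+z)` its characteristics are the
translations `w ↦ w + it`, which gives `(z - it(1+z))^m / (1 + it(1+z))^(m+1)`.

The kernel is a Fourier coefficient of this function. With `r² = 1 + t²`, `R = r + t` and `σ = |r -
t e^{iθ}|`, a rotation of the circle turns it, up to a unimodular constant, into the mean of `σ⁻¹
E`, where `|E| = 1`, `E' = i σ⁻¹ q E` and `q = (m+1/2)/σ - (n+1/2)σ`. On `[0, π]` the function `σ`
increases, so `q` decreases. Where `|q| ≥ ε`, integration by parts costs at most `4/ε` in total; the
remaining interval costs `∫ σ⁻¹`. There the increment `Δ` of `log σ` is small because `q` varies by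
at most `2ε` (`mul_log_sub_log_le`), and `∫ σ⁻¹` is controlled by `Δ + 2√(2Δ)`
(`integral_inv_chord_le`). Taking `ε = √t (n+m+1)^{1/4}` gives `4 + 8 = 12` over `ε` on each half
circle, hence the constant `24/(2π) < 4`. -/

/-- If `b` is summable and `(n + 1) b n` converges, then the limit vanishes, since the harmonic
series diverges. -/
theorem eq_zero_of_summable_of_tendsto_succ_mul {b : ℕ → ℂ} {x : ℂ} (hb : Summable b)
    (hx : Tendsto (fun n : ℕ => ((n : ℂ) + 1) * b n) atTop (𝓝 x)) : x = 0 := by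
  by_contra hne
  have hpos : 0 < ‖x‖ := norm_pos_iff.mpr hne
  have hev : ∀ᶠ n : ℕ in atTop, ‖x‖ / 2 < ‖((n : ℂ) + 1) * b n‖ :=
    hx.norm.eventually (lt_mem_nhds (by linarith))
  have hO : (fun n : ℕ => 1 / ((n : ℝ) + 1)) =O[atTop] b := by
    refine Asymptotics.IsBigO.of_bound (2 / ‖x‖) ?_
    filter_upwards [hev] with n hn
    have hn1 : (0 : ℝ) < (n : ℝ) + 1 := by positivity
    have hcast : ‖(n : ℂ) + 1‖ = (n : ℝ) + 1 := by
      have := Complex.norm_natCast (n + 1)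
      push_cast at this
      exact this
    rw [norm_mul, hcast] at hn
    rw [Real.norm_of_nonneg (by positivity), div_mul_eq_mul_div, div_le_div_iff₀ hn1 hpos]
    linarith
  have hs : Summable fun n : ℕ => 1 / ((n : ℝ) + 1) :=
    summable_of_isBigO_nat hb.norm hO.norm_right
  have := (summable_nat_add_iff (f := fun n : ℕ => 1 / (n : ℝ)) 1).mp (by simpa using hs)
  exact Real.not_summable_one_div_natCast this

theorem summable_norm_sq (u : EllTwo) : Summable fun n => ‖u n‖ ^ 2 := by
  have := (lp.memℓp u).summable (by norm_num)
  simpa using this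

/-- The Casorati determinant of two square summable sequences is summable. -/
theorem summable_casoratian (u v : EllTwo) :
    Summable fun n => conj (u (n + 1)) * v n - conj (u n) * v (n + 1) := by
  have key : ∀ f g : ℕ → ℂ, Summable (fun n => ‖f n‖ ^ 2) → Summable (fun n => ‖g n‖ ^ 2) →
      Summable fun n => conj (f n) * g n := by
    intro f g hf hg
    refine Summable.of_norm_bounded (hf.add hg) fun n => ?_
    rw [norm_mul, RCLike.norm_conj]
    nlinarith [sq_nonneg (‖f n‖ - ‖g n‖), sq_nonneg (‖f n‖ + ‖g n‖)]
  have hu := summable_norm_sq u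
  have hv := summable_norm_sq v
  exact (key (fun n => u (n + 1)) v ((summable_nat_add_iff 1).mpr hu) hv).sub
    (key u (fun n => v (n + 1)) hu ((summable_nat_add_iff 1).mpr hv))

/-- Discrete Green formula for `τ`. -/
theorem sum_range_tau_sub (u v : ℕ → ℂ) (n : ℕ) :
    ∑ k ∈ Finset.range (n + 1), (conj (tau u k) * v k - conj (u k) * tau v k) =
      ((n : ℂ) + 1) * (conj (u (n + 1)) * v n - conj (u n) * v (n + 1)) := by
  induction n with
  | zero => simp [tau]; ring
  | succ n ih =>
    rw [Finset.sum_range_succ, ih]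
    simp only [tau, map_add, map_mul, map_natCast, map_one, map_ofNat]
    push_cast
    ring

theorem H0_apply (u : H0.domain) (n : ℕ) : H0 u n = tau (u : EllTwo) n := rfl

/-- `H₀` is symmetric on its maximal domain. -/
theorem inner_H0_left (u v : H0.domain) :
    ⟪H0 u, (v : EllTwo)⟫_ℂ = ⟪(u : EllTwo), H0 v⟫_ℂ := by
  have hs := (lp.hasSum_inner (𝕜 := ℂ) (H0 u) (v : EllTwo)).sub
    (lp.hasSum_inner (𝕜 := ℂ) (u : EllTwo) (H0 v))
  -- The shift matches the partial sums over `range (n + 1)` in Green's formula.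
  have ht := (tendsto_add_atTop_iff_nat 1).mpr hs.tendsto_sum_nat
  rw [← sub_eq_zero]
  refine eq_zero_of_summable_of_tendsto_succ_mul
    (summable_casoratian (u : EllTwo) (v : EllTwo)) (ht.congr fun n => ?_)
  rw [← sum_range_tau_sub]
  refine Finset.sum_congr rfl fun k _ => ?_
  simp only [RCLike.inner_apply', H0_apply]

/-! ### The standard basis -/

theorem inner_delta_left (n : ℕ) (u : EllTwo) : ⟪delta n, u⟫_ℂ = u n := by
  simp [delta, lp.inner_single_left]

theorem delta_apply (n k : ℕ) : delta n k = if k = n then 1 else 0 := by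
  simp [delta, lp.single_apply, Pi.single_apply]

theorem eq_of_forall_inner_delta {u v : EllTwo} (h : ∀ n, ⟪delta n, u⟫_ℂ = ⟪delta n, v⟫_ℂ) :
    u = v := by
  ext n
  simpa [inner_delta_left] using h n

theorem orthonormal_delta : Orthonormal ℂ delta := by
  rw [orthonormal_iff_ite]
  intro i j
  rw [inner_delta_left, delta_apply]

theorem dense_span_delta : Dense (Submodule.span ℂ (Set.range delta) : Set EllTwo) := by
  rw [Submodule.dense_iff_topologicalClosure_eq_top,
    Submodule.topologicalClosure_eq_top_iff, Submodule.eq_bot_iff]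
  intro u hu
  refine eq_of_forall_inner_delta fun n => ?_
  rw [inner_zero_right]
  exact (Submodule.mem_orthogonal _ _).mp hu _ (Submodule.subset_span ⟨n, rfl⟩)

/-- Two bounded operators that agree on the standard basis are equal. -/
theorem clm_ext_delta {F : Type*} [NormedAddCommGroup F] [NormedSpace ℂ F]
    {A B : EllTwo →L[ℂ] F} (h : ∀ n, A (delta n) = B (delta n)) : A = B :=
  ContinuousLinearMap.ext_on dense_span_delta (by rintro _ ⟨n, rfl⟩; exact h n)

theorem delta_mem_domain (m : ℕ) : delta m ∈ H0.domain := by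
  change Memℓp (tau (delta m)) 2
  refine (memℓp_zero ?_).of_exponent_ge zero_le
  refine (Set.finite_Iic (m + 1)).subset fun n hn => ?_
  by_contra hlt
  simp only [Set.mem_Iic, not_le] at hlt
  refine hn ?_
  obtain ⟨k, rfl⟩ : ∃ k, n = k + 1 := ⟨n - 1, by omega⟩
  simp only [tau, delta_apply]
  rw [if_neg (by omega), if_neg (by omega), if_neg (by omega)]
  simp

theorem tau_delta_zero : tau (delta 0) = (delta 0 + delta 1 : EllTwo) := by
  funext k
  rcases k with _ | _ | k <;> simp [tau, delta_apply]

theorem tau_delta_succ (n : ℕ) :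
    tau (delta (n + 1)) = (((n : ℂ) + 1) • delta n + (2 * ((n : ℂ) + 1) + 1) • delta (n + 1)
      + (((n : ℂ) + 1) + 1) • delta (n + 2) : EllTwo) := by
  funext k
  rcases k with _ | k
  · rcases n with _ | n <;>
      simp only [tau, delta_apply, lp.coeFn_add, lp.coeFn_smul, Pi.add_apply, Pi.smul_apply] <;>
      simp
  · simp only [tau, delta_apply, lp.coeFn_add, lp.coeFn_smul, Pi.add_apply, Pi.smul_apply,
      smul_eq_mul]
    rcases lt_trichotomy k n with h | h | h
    · by_cases h1 : k + 1 = n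
      · subst h1; simp; omega
      · simp [show k ≠ n + 1 by omega, show k ≠ n by omega, h1]
    · subst h; simp
    · by_cases h1 : k = n + 1
      · subst h1; simp; omega
      · simp [show k ≠ n by omega, h1, show k + 1 ≠ n by omega]

/-- Pairing with `H₀ δ_n` evaluates `τ`, also outside the domain. -/
theorem inner_H0_delta_left (n : ℕ) (u : EllTwo) :
    ⟪H0 ⟨delta n, delta_mem_domain n⟩, u⟫_ℂ = tau u n := by
  rcases n with _ | n
  · have h : H0 ⟨delta 0, delta_mem_domain 0⟩ = delta 0 + delta 1 := lp.ext tau_delta_zero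
    rw [h, inner_add_left, inner_delta_left, inner_delta_left, tau]
  · have h : H0 ⟨delta (n + 1), delta_mem_domain (n + 1)⟩ = _ := lp.ext (tau_delta_succ n)
    rw [h]
    simp only [inner_add_left, inner_smul_left, inner_delta_left, tau, map_add, map_mul,
      map_natCast, map_one, map_ofNat]

/-! ### Solutions of the Schrödinger equation and evolution groups -/

/-- `c` is a strong solution of `i c' = H₀ c`. -/
def IsSolution (c : ℝ → EllTwo) : Prop :=
  ∀ t, ∃ h : c t ∈ H0.domain, HasDerivAt c (-Complex.I • H0 ⟨c t, h⟩) t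

theorem IsSolution.comp_add_const {c : ℝ → EllTwo} (hc : IsSolution c) (a : ℝ) :
    IsSolution fun t => c (a + t) := fun t => by
  obtain ⟨h, hd⟩ := hc (a + t)
  exact ⟨h, by simpa using hd.comp_const_add a t⟩

theorem hasDerivAt_comp_neg {c : ℝ → EllTwo} {w : EllTwo} {t : ℝ} (h : HasDerivAt c w (-t)) :
    HasDerivAt (fun s => c (-s)) (-w) t := by
  simpa [Function.comp_def] using h.scomp t (hasDerivAt_neg t)

/-- Inner products of solutions are conserved. -/
theorem IsSolution.inner_eq {c d : ℝ → EllTwo} (hc : IsSolution c) (hd : IsSolution d)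
    (s t : ℝ) : ⟪c s, d s⟫_ℂ = ⟪c t, d t⟫_ℂ := by
  have hder : ∀ x, HasDerivAt (fun x => ⟪c x, d x⟫_ℂ) 0 x := by
    intro x
    obtain ⟨h1, hd1⟩ := hc x
    obtain ⟨h2, hd2⟩ := hd x
    have h := hd1.inner ℂ hd2
    have hz : ⟪c x, -Complex.I • H0 ⟨d x, h2⟩⟫_ℂ + ⟪-Complex.I • H0 ⟨c x, h1⟩, d x⟫_ℂ = 0 := by
      have := inner_H0_left ⟨c x, h1⟩ ⟨d x, h2⟩
      simp only at this
      rw [inner_smul_left, inner_smul_right, this]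
      simp
    rwa [hz] at h
  exact is_const_of_deriv_eq_zero (fun x => (hder x).differentiableAt)
    (fun x => (hder x).deriv) s t

theorem IsEvolutionGroup.isSolution {U : ℝ → EllTwo →L[ℂ] EllTwo}
    (hU : IsEvolutionGroup H0 U) (u : H0.domain) : IsSolution fun t => U t u := by
  intro t
  have h0 : HasDerivAt (fun s => U s (U t u)) (U t (-Complex.I • H0 u)) 0 := by
    have h : HasDerivAt (fun s => U t (U s u)) (U t (-Complex.I • H0 u)) 0 :=
      ((U t).restrictScalars ℝ).hasFDerivAt.comp_hasDerivAt 0 (hU.hasDerivAt u)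
    refine h.congr_of_eventuallyEq (Eventually.of_forall fun s => ?_)
    change (U s * U t) u = (U t * U s) u
    rw [← hU.map_add, ← hU.map_add, add_comm]
  -- Invariance of the domain: since the group commutes, the orbit of `U t u` is differentiable at
  -- `0`, and such vectors lie in the domain by maximality of the generator.
  have hmem : U t u ∈ H0.domain := hU.mem_domain _ h0.differentiableAt
  refine ⟨hmem, ?_⟩
  have h1 := hU.hasDerivAt ⟨U t u, hmem⟩
  have h2 : HasDerivAt (fun s => U (s - t) (U t u)) (-Complex.I • H0 ⟨U t u, hmem⟩) t := by
    refine HasDerivAt.comp_sub_const (f := fun s => U s (U t u)) t t ?_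
    rwa [sub_self]
  refine h2.congr_of_eventuallyEq (Eventually.of_forall fun s => ?_)
  change U s u = (U (s - t) * U t) u
  rw [← hU.map_add, sub_add_cancel]

/-- The evolution group is determined by any family of solutions starting at the basis. -/
theorem IsEvolutionGroup.apply_delta {U : ℝ → EllTwo →L[ℂ] EllTwo}
    (hU : IsEvolutionGroup H0 U) {m : ℕ} {c : ℝ → EllTwo} (hc : IsSolution c)
    (h0 : c 0 = delta m) (t : ℝ) : U t (delta m) = c t := by
  have hsol : ∀ n, IsSolution fun t => U t (delta n) := fun n =>
    hU.isSolution ⟨delta n, delta_mem_domain n⟩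
  have h2 : U t * star (U t) = 1 := (Unitary.mem_iff.mp (hU.unitary t)).2
  -- The coefficients of `U(t)* c(t)` are `⟪U t δ_n, c t⟫`, which are conserved and equal `⟪δ_n,
  -- δ_m⟫` at time `0`.
  have h3 : star (U t) (c t) = delta m := by
    refine eq_of_forall_inner_delta fun n => ?_
    rw [ContinuousLinearMap.star_eq_adjoint, ContinuousLinearMap.adjoint_inner_right,
      (hsol n).inner_eq hc t 0, hU.map_zero, h0]
    rfl
  rw [← h3]
  exact congr($h2 (c t))

theorem IsEvolutionGroup.unique {U W : ℝ → EllTwo →L[ℂ] EllTwo}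
    (hU : IsEvolutionGroup H0 U) (hW : IsEvolutionGroup H0 W) : U = W := by
  funext t
  refine clm_ext_delta fun m => ?_
  refine hU.apply_delta (hW.isSolution ⟨delta m, delta_mem_domain m⟩) ?_ t
  rw [hW.map_zero]
  rfl

/-! ### Construction of the unitary group from the basis solutions -/

theorem orthonormal_of_isSolution {c : ℕ → ℝ → EllTwo} (hc : ∀ m, IsSolution (c m))
    (h0 : ∀ m, c m 0 = delta m) (t : ℝ) : Orthonormal ℂ fun m => c m t := by
  rw [orthonormal_iff_ite]
  intro i j
  rw [(hc i).inner_eq (hc j) t 0, h0, h0]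
  exact orthonormal_iff_ite.mp orthonormal_delta i j

/-- The isometry of `ℓ²(ℕ₀)` sending the standard basis to a given orthonormal sequence. -/
def basisIsometry {E : Type*} [NormedAddCommGroup E] [InnerProductSpace ℂ E] [CompleteSpace E]
    {v : ℕ → E} (hv : Orthonormal ℂ v) : EllTwo →ₗᵢ[ℂ] E :=
  hv.orthogonalFamily.linearIsometry

theorem basisIsometry_delta {E : Type*} [NormedAddCommGroup E] [InnerProductSpace ℂ E]
    [CompleteSpace E] {v : ℕ → E} (hv : Orthonormal ℂ v) (n : ℕ) :
    basisIsometry hv (delta n) = v n := by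
  simp [basisIsometry, delta, OrthogonalFamily.linearIsometry_apply_single]

/-- `V` is the family of isometries that sends the standard basis to the solutions `c` starting
there. -/
structure IsBasisFlow (c : ℕ → ℝ → EllTwo) (V : ℝ → EllTwo →L[ℂ] EllTwo) : Prop where
  isSolution : ∀ m, IsSolution (c m)
  zero : ∀ m, c m 0 = delta m
  apply_delta : ∀ t m, V t (delta m) = c m t
  norm_map : ∀ t u, ‖V t u‖ = ‖u‖

theorem exists_isBasisFlow {c : ℕ → ℝ → EllTwo} (hc : ∀ m, IsSolution (c m))
    (h0 : ∀ m, c m 0 = delta m) : ∃ V, IsBasisFlow c V :=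
  ⟨fun t => (basisIsometry (orthonormal_of_isSolution hc h0 t)).toContinuousLinearMap, hc, h0,
    fun t m => basisIsometry_delta (orthonormal_of_isSolution hc h0 t) m, fun t u =>
      (basisIsometry (orthonormal_of_isSolution hc h0 t)).norm_map u⟩

namespace IsBasisFlow

variable {c : ℕ → ℝ → EllTwo} {V : ℝ → EllTwo →L[ℂ] EllTwo}

/-- The weak form of `V(t)* = V(-t)`. On the basis it is conservation of the inner product of `c n`
with a time-translate of `c m`; density does the rest. It moves the time dependence of a matrix
entry onto `c n`, whose derivative is known. -/
theorem inner_delta_apply (h : IsBasisFlow c V) (t : ℝ) (n : ℕ) (u : EllTwo) :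
    ⟪delta n, V t u⟫_ℂ = ⟪c n (-t), u⟫_ℂ := by
  suffices (innerSL ℂ (delta n)).comp (V t) = innerSL ℂ (c n (-t)) from congr($this u)
  refine clm_ext_delta fun m => ?_
  change ⟪delta n, V t (delta m)⟫_ℂ = ⟪c n (-t), delta m⟫_ℂ
  rw [h.apply_delta, ← h.zero n, ← h.zero m]
  simpa using (h.isSolution n).inner_eq
    ((h.isSolution m).comp_add_const t) 0 (-t)

theorem map_add (h : IsBasisFlow c V) (s t : ℝ) : V (s + t) = V s * V t := by
  refine clm_ext_delta fun m => eq_of_forall_inner_delta fun n => ?_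
  change _ = ⟪delta n, V s (V t (delta m))⟫_ℂ
  rw [h.inner_delta_apply s, h.apply_delta, h.apply_delta, ← h.zero n]
  simpa using (h.isSolution n).inner_eq
    ((h.isSolution m).comp_add_const (s + t)) 0 (-s)

theorem map_zero (h : IsBasisFlow c V) : V 0 = 1 :=
  clm_ext_delta fun m => by rw [h.apply_delta, h.zero]; rfl

theorem mem_unitary (h : IsBasisFlow c V) (t : ℝ) : V t ∈ unitary (EllTwo →L[ℂ] EllTwo) := by
  have h1 : star (V t) * V t = 1 :=
    (ContinuousLinearMap.norm_map_iff_adjoint_comp_self (V t)).mp (h.norm_map t)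
  -- An isometry supplies only the left inverse; the group law supplies the right one.
  have h2 : V t * V (-t) = 1 := by rw [← h.map_add, add_neg_cancel, h.map_zero]
  refine Unitary.mem_iff.mpr ⟨h1, ?_⟩
  rwa [left_inv_eq_right_inv h1 h2]

theorem continuous_apply (h : IsBasisFlow c V) (u : EllTwo) : Continuous fun t => V t u := by
  have hspan : ∀ w ∈ Submodule.span ℂ (Set.range delta), Continuous fun t => V t w := by
    intro w hw
    induction hw using Submodule.span_induction with
    | mem x hx =>
      obtain ⟨m, rfl⟩ := hx
      simp only [h.apply_delta]
      exact continuous_iff_continuousAt.mpr fun t => (h.isSolution m t).choose_spec.continuousAt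
    | zero => simpa using continuous_const
    | add x y _ _ hx hy => simpa only [_root_.map_add] using! hx.add hy
    | smul a x _ hx => simpa only [map_smul] using! hx.const_smul a
  -- Approximating `u` by finite combinations of the basis is uniform in time because every `V t` is
  -- isometric.
  refine continuous_of_uniform_approx_of_continuous fun s hs => ?_
  obtain ⟨ε, hε, hs⟩ := Metric.mem_uniformity_dist.mp hs
  obtain ⟨w, hw, hd⟩ := Metric.mem_closure_iff.mp (dense_span_delta u) ε hε
  refine ⟨fun t => V t w, hspan w hw, fun t => hs ?_⟩
  rwa [dist_eq_norm, ← map_sub, h.norm_map, ← dist_eq_norm]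

theorem hasDerivAt_inner (h : IsBasisFlow c V) (u : H0.domain) (n : ℕ) (t : ℝ) :
    HasDerivAt (fun t => ⟪delta n, V t u⟫_ℂ) ⟪delta n, V t (-Complex.I • H0 u)⟫_ℂ t := by
  simp only [h.inner_delta_apply]
  obtain ⟨hm, hd⟩ := h.isSolution n (-t)
  have h1 := (hasDerivAt_comp_neg hd).inner ℂ (hasDerivAt_const t (u : EllTwo))
  refine h1.congr_deriv ?_
  have := inner_H0_left ⟨c n (-t), hm⟩ u
  simp only at this
  rw [inner_zero_right, zero_add, inner_neg_left, inner_smul_left, inner_smul_right, this]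
  simp

theorem hasDerivAt (h : IsBasisFlow c V) (u : H0.domain) :
    HasDerivAt (fun t => V t u) (-Complex.I • H0 u) 0 := by
  have hcont := h.continuous_apply (-Complex.I • H0 u)
  -- The weak derivatives are integrated coordinate by coordinate into a vector-valued Duhamel
  -- identity. Its integrand is norm continuous, so the fundamental theorem of calculus then yields
  -- a strong derivative.
  have hint : ∀ t, V t u = u + ∫ s in (0 : ℝ)..t, V s (-Complex.I • H0 u) := by
    intro t
    refine eq_of_forall_inner_delta fun n => ?_
    have hii := hcont.intervalIntegrable (μ := MeasureTheory.volume) 0 t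
    have hcomm := (innerSL ℂ (delta n)).intervalIntegral_comp_comm hii
    simp only [innerSL_apply_apply] at hcomm
    rw [inner_add_right, ← hcomm, intervalIntegral.integral_eq_sub_of_hasDerivAt
      (fun x _ => h.hasDerivAt_inner u n x)
      ((((innerSL ℂ (delta n)).continuous.comp hcont)).intervalIntegrable _ _), h.map_zero]
    simp
  have hder := (hcont.integral_hasStrictDerivAt 0 0).hasDerivAt.const_add (u : EllTwo)
  rw [h.map_zero] at hder
  exact hder.congr_of_eventuallyEq (Eventually.of_forall hint)

/-- If the orbit has derivative `w` at `0`, differentiating each coordinate by moving time onto `c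
n` gives `τ u = i w`. The right side is square summable, which is exactly membership in the maximal
domain. -/
theorem mem_domain (h : IsBasisFlow c V) (u : EllTwo)
    (hu : DifferentiableAt ℝ (fun t => V t u) 0) : u ∈ H0.domain := by
  obtain ⟨w, hw⟩ : ∃ w, HasDerivAt (fun t => V t u) w 0 := ⟨_, hu.hasDerivAt⟩
  have key : tau u = (Complex.I • w : EllTwo) := by
    funext n
    have h1 : HasDerivAt (fun t => ⟪delta n, V t u⟫_ℂ) ⟪delta n, w⟫_ℂ 0 := by
      simpa using (hasDerivAt_const (0 : ℝ) (delta n)).inner ℂ hw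
    obtain ⟨hm, hd⟩ := h.isSolution n (-0)
    have h2 := (hasDerivAt_comp_neg hd).inner ℂ (hasDerivAt_const (0 : ℝ) u)
    simp only [← h.inner_delta_apply] at h2
    have h3 := h1.unique h2
    have h4 : (⟨c n (-0), hm⟩ : H0.domain) = ⟨delta n, delta_mem_domain n⟩ :=
      Subtype.ext (by simp [h.zero])
    rw [h4, _root_.map_zero, inner_zero_right, zero_add, inner_neg_left, inner_smul_left, inner_H0_delta_left,
      inner_delta_left] at h3
    rw [lp.coeFn_smul, Pi.smul_apply, h3]
    simp [← mul_assoc]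
  change Memℓp (tau u) 2
  rw [key]
  exact lp.memℓp _

theorem isEvolutionGroup (h : IsBasisFlow c V) : IsEvolutionGroup H0 V :=
  ⟨h.map_zero, h.map_add, h.mem_unitary, h.continuous_apply, h.hasDerivAt, h.mem_domain⟩

end IsBasisFlow

/-- Existence and uniqueness of the evolution group from solutions starting at the basis. -/
theorem existsUnique_isEvolutionGroup {c : ℕ → ℝ → EllTwo} (hc : ∀ m, IsSolution (c m))
    (h0 : ∀ m, c m 0 = delta m) : ∃! U, IsEvolutionGroup H0 U := by
  obtain ⟨V, hV⟩ := exists_isBasisFlow hc h0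
  exact ⟨V, hV.isEvolutionGroup, fun W hW => hW.unique hV.isEvolutionGroup⟩

/-! ### Explicit solutions through the Hardy space of the circle -/

/-- The circle of length `2π`. -/
abbrev Circ : Type := AddCircle (2 * Real.pi)

instance : Fact (0 < 2 * Real.pi) := ⟨Real.two_pi_pos⟩

/-- The mean value of a continuous function on the circle. -/
def circMean : C(Circ, ℂ) →L[ℂ] ℂ :=
  (innerSL ℂ (fourierLp (T := 2 * Real.pi) 2 0)).comp
    (ContinuousMap.toLp (E := ℂ) 2 AddCircle.haarAddCircle ℂ)

theorem circMean_eq (f : C(Circ, ℂ)) : circMean f = ∫ x, f x ∂AddCircle.haarAddCircle := by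
  change ⟪fourierLp (T := 2 * Real.pi) 2 0,
    ContinuousMap.toLp (E := ℂ) 2 AddCircle.haarAddCircle ℂ f⟫_ℂ = _
  rw [MeasureTheory.ContinuousMap.inner_toLp]
  simp

theorem circMean_eq_intervalIntegral (f : C(Circ, ℂ)) (a : ℝ) :
    circMean f = (1 / (2 * Real.pi)) • ∫ x in a..a + 2 * Real.pi, f (x : Circ) := by
  have h := fourierCoeff_eq_intervalIntegral (T := 2 * Real.pi) (fun x => f x) 0 a
  simpa [fourierCoeff, circMean_eq] using h

theorem orthonormal_fourier_natCast :
    Orthonormal ℂ (fourierLp (T := 2 * Real.pi) 2 ∘ fun n : ℕ => (n : ℤ)) :=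
  orthonormal_fourier.comp _ Nat.cast_injective

/-- The projection onto the Hardy space: nonnegative Fourier coefficients. -/
def hardyCoeff : C(Circ, ℂ) →L[ℂ] EllTwo :=
  (ContinuousLinearMap.adjoint (basisIsometry orthonormal_fourier_natCast).toContinuousLinearMap).comp
    (ContinuousMap.toLp (E := ℂ) 2 AddCircle.haarAddCircle ℂ)

theorem hardyCoeff_apply (f : C(Circ, ℂ)) (n : ℕ) :
    hardyCoeff f n = circMean (fourier (-(n : ℤ)) * f) := by
  rw [← inner_delta_left, hardyCoeff, ContinuousLinearMap.comp_apply,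
    ContinuousLinearMap.adjoint_inner_right]
  change ⟪basisIsometry orthonormal_fourier_natCast (delta n), _⟫_ℂ = _
  rw [basisIsometry_delta, Function.comp_apply, MeasureTheory.ContinuousMap.inner_toLp, circMean_eq]
  refine MeasureTheory.integral_congr_ae (Eventually.of_forall fun x => ?_)
  simp only [ContinuousMap.mul_apply, fourier_neg]
  ring

theorem hardyCoeff_fourier (m : ℕ) : hardyCoeff (fourier (m : ℤ)) = delta m := by
  have h := basisIsometry_delta orthonormal_fourier_natCast m
  rw [hardyCoeff, ContinuousLinearMap.comp_apply]
  change ContinuousLinearMap.adjoint _ (fourierLp 2 (m : ℤ)) = _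
  rw [Function.comp_apply] at h
  rw [← h]
  exact congr($((ContinuousLinearMap.norm_map_iff_adjoint_comp_self _).mp
    (LinearIsometry.norm_map _)) (delta m))

theorem circMean_eq_zero_of_hasDerivAt {f g : C(Circ, ℂ)}
    (h : ∀ x : ℝ, HasDerivAt (fun y : ℝ => f (y : Circ)) (g (x : Circ)) x) : circMean g = 0 := by
  rw [circMean_eq_intervalIntegral g 0, intervalIntegral.integral_eq_sub_of_hasDerivAt
    (fun x _ => h x) ((g.continuous.comp (AddCircle.continuous_mk' _)).intervalIntegrable _ _)]
  rw [zero_add, AddCircle.coe_period, QuotientAddGroup.mk_zero, sub_self, smul_zero]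

theorem hasDerivAt_fourier_two_pi (n : ℤ) (x : ℝ) :
    HasDerivAt (fun y : ℝ => (fourier n (y : Circ) : ℂ))
      (Complex.I * n * fourier n (x : Circ)) x := by
  refine (hasDerivAt_fourier (2 * Real.pi) n x).congr_deriv ?_
  have : (Real.pi : ℂ) ≠ 0 := by exact_mod_cast Real.pi_ne_zero
  push_cast
  field_simp

/-- The boundary value of the function `z ↦ 1 + z`. -/
def onePlus : C(Circ, ℂ) := 1 + fourier 1

/-- `τ` acts on boundary values of holomorphic functions as `f ↦ (1+z)² f' + (1+z) f`. -/
theorem tau_hardyCoeff {f g : C(Circ, ℂ)} (h : ∀ x : ℝ, HasDerivAt (fun y : ℝ => f (y : Circ))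
      (Complex.I * fourier 1 (x : Circ) * g (x : Circ)) x) :
    tau (hardyCoeff f) = hardyCoeff (onePlus ^ 2 * g + onePlus * f) := by
  -- For every integer `n`, the difference of the two sides is, up to a factor `i`, the mean of the
  -- `θ`-derivative of `z^{-(n+1)} (1+z)² f`, hence zero.
  have key : ∀ n : ℤ, circMean (fourier (-n) * (onePlus ^ 2 * g + onePlus * f)) =
      n * circMean (fourier (-(n - 1)) * f) + (2 * n + 1) * circMean (fourier (-n) * f) +
        (n + 1) * circMean (fourier (-(n + 1)) * f) := by
    intro n
    have hz : circMean (Complex.I • (fourier (-n) * (onePlus ^ 2 * g + onePlus * f) -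
        ((n : ℂ) • (fourier (-(n - 1)) * f) + (2 * n + 1 : ℂ) • (fourier (-n) * f) +
        (n + 1 : ℂ) • (fourier (-(n + 1)) * f)))) = 0 := by
      refine circMean_eq_zero_of_hasDerivAt
        (f := (fourier (-(n - 1)) + (2 : ℂ) • fourier (-n) + fourier (-(n + 1))) * f) fun x => ?_
      refine ((((hasDerivAt_fourier_two_pi (-(n - 1)) x).add
        ((hasDerivAt_fourier_two_pi (-n) x).const_mul 2)).add
        (hasDerivAt_fourier_two_pi (-(n + 1)) x)).mul (h x)).congr_deriv ?_
      have e1 : (fourier (-(n - 1)) (x : Circ) : ℂ) = fourier (-n) (x : Circ) *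
          fourier 1 (x : Circ) := by rw [← fourier_add]; congr 2; ring
      have e2 : (fourier (-n) (x : Circ) : ℂ) = fourier (-(n + 1)) (x : Circ) *
          fourier 1 (x : Circ) := by rw [← fourier_add]; congr 2; ring
      simp only [onePlus, Pi.add_apply, ContinuousMap.smul_apply, ContinuousMap.sub_apply,
        ContinuousMap.add_apply, ContinuousMap.mul_apply, ContinuousMap.pow_apply,
        ContinuousMap.one_apply, smul_eq_mul]
      rw [e1, e2]
      push_cast
      ring
    simp only [map_smul, map_sub, map_add, smul_eq_mul, mul_eq_zero, Complex.I_ne_zero, false_or,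
      sub_eq_zero] at hz
    exact hz
  funext n
  rw [hardyCoeff_apply, key]
  rcases n with _ | n
  -- At `n = 0` the coefficient of index `-1` carries the factor `n = 0`. The recursion thus
  -- decouples from negative frequencies, and no holomorphy of `f` is needed.
  · simp [tau, hardyCoeff_apply]
  · simp only [tau, hardyCoeff_apply]
    push_cast
    rw [show (n : ℤ) + 1 - 1 = n by ring, show (n : ℤ) + 1 + 1 = n + 2 by ring]

/-- The boundary value of `1 + it(1 + z)`. -/
def denom (t : ℝ) : C(Circ, ℂ) := 1 + (Complex.I * t) • onePlus

theorem norm_fourier_apply (n : ℤ) (x : Circ) : ‖(fourier n x : ℂ)‖ = 1 := Circle.norm_coe _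

theorem denom_apply_ne_zero (t : ℝ) (x : Circ) : denom t x ≠ 0 := by
  intro h
  have h1 : (1 : ℂ) + Complex.I * t = -(Complex.I * t * fourier 1 x) := by
    have : (1 : ℂ) + Complex.I * t * (1 + fourier 1 x) = 0 := by
      simpa only [denom, onePlus, ContinuousMap.add_apply, ContinuousMap.smul_apply,
        ContinuousMap.one_apply, smul_eq_mul] using h
    linear_combination this
  -- A zero would force `1 + t² = t²`.
  have h2 := congrArg (fun w : ℂ => ‖w‖ ^ 2) h1
  simp only [norm_neg, norm_mul, norm_fourier_apply, Complex.sq_norm, Complex.norm_I,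
    Complex.norm_real] at h2
  simp [Complex.normSq_apply] at h2
  nlinarith

theorem isUnit_denom (t : ℝ) : IsUnit (denom t) :=
  ContinuousMap.isUnit_iff_forall_ne_zero _ |>.mpr (denom_apply_ne_zero t)

/-- The boundary value of `1 / (1 + it(1 + z))`. -/
def denomInv (t : ℝ) : C(Circ, ℂ) := Ring.inverse (denom t)

theorem denom_mul_denomInv (t : ℝ) : denom t * denomInv t = 1 :=
  Ring.mul_inverse_cancel _ (isUnit_denom t)

theorem denomInv_apply (t : ℝ) (x : Circ) : denomInv t x = (denom t x)⁻¹ :=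
  eq_inv_of_mul_eq_one_right congr($(denom_mul_denomInv t) x)

/-- Differentiating inversion in the Banach algebra `C(Circ, ℂ)` gives a time derivative in sup
norm, which the bounded map `hardyCoeff` later carries to `ℓ²`. -/
theorem hasDerivAt_denomInv (t : ℝ) :
    HasDerivAt denomInv (-(Complex.I • (onePlus * denomInv t ^ 2))) t := by
  have h1 : HasDerivAt denom (Complex.I • onePlus) t := by
    have : HasDerivAt (fun s : ℝ => Complex.I * (s : ℂ)) Complex.I t := by
      simpa using (Complex.ofRealCLM.hasDerivAt (x := t)).const_mul Complex.I
    exact (this.smul_const onePlus).const_add 1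
  obtain ⟨w, hw⟩ := isUnit_denom t
  have h2 := (hasFDerivAt_ringInverse (𝕜 := ℝ) w)
  rw [hw] at h2
  have h3 := h2.comp_hasDerivAt t h1
  refine h3.congr_deriv ?_
  have h4 : denomInv t = ((w⁻¹ : C(Circ, ℂ)ˣ) : C(Circ, ℂ)) := by
    rw [denomInv, ← hw, Ring.inverse_unit]
  rw [h4]
  simp only [neg_apply, ContinuousLinearMap.mulLeftRight_apply]
  rw [mul_smul_comm, smul_mul_assoc]
  congr 2
  ring

/-- The generating function `(z - it(1+z))^m / (1 + it(1+z))^(m+1)` of the solution starting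
at `δ_m`. -/
def wave (m : ℕ) (t : ℝ) : C(Circ, ℂ) := (onePlus * denomInv t - 1) ^ m * denomInv t

/-- The complex derivative of `wave`. -/
def waveDeriv (m : ℕ) (t : ℝ) : C(Circ, ℂ) :=
  -- The `z`-derivative of `(1+z)/(1+it(1+z)) - 1` is `denomInv t ^ 2`. The truncated exponent at `m
  -- = 0` is harmless because of the factor `m`.
  m • ((onePlus * denomInv t - 1) ^ (m - 1) * denomInv t ^ 3) -
    (Complex.I * t) • ((onePlus * denomInv t - 1) ^ m * denomInv t ^ 2)

theorem hasDerivAt_wave (m : ℕ) (t : ℝ) : HasDerivAt (wave m)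
    (-Complex.I • (onePlus ^ 2 * waveDeriv m t + onePlus * wave m t)) t := by
  have hG := hasDerivAt_denomInv t
  have h := (((hG.const_mul onePlus).sub_const 1).pow m).mul hG
  refine h.congr_deriv ?_
  have hD := denom_mul_denomInv t
  ext x
  have hDx : (1 + Complex.I * t * (1 + fourier 1 x)) * denomInv t x = 1 := by
    simpa only [denom, onePlus, ContinuousMap.add_apply, ContinuousMap.smul_apply,
        ContinuousMap.one_apply, smul_eq_mul, ContinuousMap.mul_apply] using congr($hD x)
  simp only [wave, waveDeriv, onePlus, ContinuousMap.smul_apply, ContinuousMap.sub_apply,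
    ContinuousMap.add_apply, ContinuousMap.mul_apply, ContinuousMap.pow_apply,
    ContinuousMap.one_apply, smul_eq_mul, ContinuousMap.neg_apply, nsmul_eq_mul, Pi.pow_apply,
    ContinuousMap.natCast_apply]
  linear_combination (-Complex.I * ((1 + fourier 1 x) * denomInv t x - 1) ^ m * (1 + fourier 1 x)
    * denomInv t x) * hDx

theorem hasDerivAt_wave_coe (m : ℕ) (t x : ℝ) :
    HasDerivAt (fun y : ℝ => wave m t (y : Circ))
      (Complex.I * fourier 1 (x : Circ) * waveDeriv m t (x : Circ)) x := by
  have hz : HasDerivAt (fun y : ℝ => (fourier 1 (y : Circ) : ℂ))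
      (Complex.I * fourier 1 (x : Circ)) x := by
    simpa only [Int.cast_one, mul_one] using hasDerivAt_fourier_two_pi 1 x
  have he : HasDerivAt (fun y : ℝ => onePlus (y : Circ)) (Complex.I * fourier 1 (x : Circ)) x :=
    hz.const_add 1
  have hD : HasDerivAt (fun y : ℝ => denom t (y : Circ))
      (Complex.I * t * (Complex.I * fourier 1 (x : Circ))) x :=
    (he.const_mul (Complex.I * (t : ℂ))).const_add 1
  have hG : HasDerivAt (fun y : ℝ => denomInv t (y : Circ))
      (-(Complex.I * t * (Complex.I * fourier 1 (x : Circ))) * denomInv t (x : Circ) ^ 2) x := by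
    simp only [denomInv_apply]
    refine (hD.inv (denom_apply_ne_zero t x)).congr_deriv ?_
    rw [inv_pow, div_eq_mul_inv]
  have h := (((he.mul hG).sub_const 1).pow m).mul hG
  refine h.congr_deriv ?_
  have hDx : (1 + Complex.I * t * onePlus (x : Circ)) * denomInv t (x : Circ) = 1 :=
    congr($(denom_mul_denomInv t) (x : Circ))
  simp only [waveDeriv, ContinuousMap.smul_apply, ContinuousMap.sub_apply,
    ContinuousMap.mul_apply, ContinuousMap.pow_apply,
    ContinuousMap.one_apply, smul_eq_mul, nsmul_eq_mul, Pi.pow_apply,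
    Pi.mul_apply, ContinuousMap.natCast_apply]
  linear_combination (-(m : ℂ) * (onePlus (x : Circ) * denomInv t (x : Circ) - 1) ^ (m - 1) *
    Complex.I * fourier 1 (x : Circ) * denomInv t (x : Circ) ^ 2) * hDx

/-- The solution starting at `δ_m`. -/
def basisSolution (m : ℕ) (t : ℝ) : EllTwo := hardyCoeff (wave m t)

theorem isSolution_basisSolution (m : ℕ) : IsSolution (basisSolution m) := by
  intro t
  have htau : tau (basisSolution m t) =
      hardyCoeff (onePlus ^ 2 * waveDeriv m t + onePlus * wave m t) :=
    tau_hardyCoeff (hasDerivAt_wave_coe m t)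
  have hmem : basisSolution m t ∈ H0.domain := by
    change Memℓp (tau (basisSolution m t)) 2
    rw [htau]
    exact lp.memℓp _
  refine ⟨hmem, ?_⟩
  have hH : H0 ⟨basisSolution m t, hmem⟩ =
      hardyCoeff (onePlus ^ 2 * waveDeriv m t + onePlus * wave m t) := lp.ext htau
  rw [hH, ← map_smul]
  exact (hardyCoeff.restrictScalars ℝ).hasFDerivAt.comp_hasDerivAt t (hasDerivAt_wave m t)

theorem basisSolution_zero (m : ℕ) : basisSolution m 0 = delta m := by
  rw [basisSolution, ← hardyCoeff_fourier]
  congr 1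
  have h1 : denomInv 0 = 1 := by simp [denomInv, denom]
  ext x
  simp only [wave, h1, onePlus, mul_one, add_sub_cancel_left, ContinuousMap.pow_apply]
  induction m with
  | zero => simp
  | succ m ih => rw [pow_succ, ih, Nat.cast_succ, fourier_add]

/-! ### Oscillatory integrals -/

/-- Integration by parts for `∫ p E` where `E' = i p q E`, `|E| = 1` and `q` is nonincreasing. -/
theorem norm_integral_le_of_hasDerivAt_phase {E : ℝ → ℂ} {p q q' : ℝ → ℝ} {a b : ℝ} (hab : a ≤ b)
    (hE : ∀ x, HasDerivAt E (Complex.I * p x * q x * E x) x) (hn : ∀ x, ‖E x‖ = 1)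
    (hq : ∀ x, HasDerivAt q (q' x) x) (hp : Continuous p) (hq' : Continuous q')
    (hneg : ∀ x ∈ Set.Icc a b, q' x ≤ 0) (h0 : ∀ x ∈ Set.Icc a b, q x ≠ 0) :
    ‖∫ x in a..b, (p x : ℂ) * E x‖ ≤ |q a|⁻¹ + |q b|⁻¹ + ((q b)⁻¹ - (q a)⁻¹) := by
  have hEc : Continuous E := continuous_iff_continuousAt.mpr fun x => (hE x).continuousAt
  have hqc : Continuous q := continuous_iff_continuousAt.mpr fun x => (hq x).continuousAt
  have hu : Set.uIcc a b = Set.Icc a b := Set.uIcc_of_le hab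
  have hcr : ContinuousOn (fun x => -q' x / q x ^ 2) (Set.uIcc a b) := by
    rw [hu]
    exact hq'.neg.continuousOn.div (hqc.pow 2).continuousOn fun x hx => pow_ne_zero 2 (h0 x hx)
  have hcr' : ContinuousOn (fun x => E x * ((-q' x / q x ^ 2 : ℝ) : ℂ)) (Set.uIcc a b) :=
    hEc.continuousOn.mul (Complex.continuous_ofReal.comp_continuousOn hcr)
  have hcp : Continuous fun x => (p x : ℂ) * E x := (Complex.continuous_ofReal.comp hp).mul hEc
  have hcI : Continuous fun x => Complex.I * ((p x : ℂ) * E x) := continuous_const.mul hcp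
  -- The integrand is the derivative of `E / q`.
  have h1 : ∫ x in a..b, (Complex.I * ((p x : ℂ) * E x) + E x * ((-q' x / q x ^ 2 : ℝ) : ℂ)) =
      E b * ((q b)⁻¹ : ℝ) - E a * ((q a)⁻¹ : ℝ) := by
    refine intervalIntegral.integral_eq_sub_of_hasDerivAt
      (f := fun x => E x * (((q x)⁻¹ : ℝ) : ℂ)) (fun x hx => ?_) ?_
    · have hx0 : q x ≠ 0 := h0 x (hu ▸ hx)
      have hx0' : (q x : ℂ) ≠ 0 := by exact_mod_cast hx0
      refine ((hE x).mul ((hq x).inv hx0).ofReal_comp).congr_deriv ?_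
      simp only [Pi.inv_apply]
      push_cast
      field_simp
    · exact (hcI.continuousOn.add hcr').intervalIntegrable
  rw [intervalIntegral.integral_add (hcI.intervalIntegrable _ _)
    hcr'.intervalIntegrable, intervalIntegral.integral_const_mul] at h1
  have h2 : ‖∫ x in a..b, E x * ((-q' x / q x ^ 2 : ℝ) : ℂ)‖ ≤ (q b)⁻¹ - (q a)⁻¹ := by
    have h3 : ∫ x in a..b, -q' x / q x ^ 2 = (q b)⁻¹ - (q a)⁻¹ :=
      intervalIntegral.integral_eq_sub_of_hasDerivAt
        (fun x hx => (hq x).inv (h0 x (hu ▸ hx))) hcr.intervalIntegrable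
    rw [← h3]
    refine intervalIntegral.norm_integral_le_of_norm_le hab
      (MeasureTheory.ae_of_all _ fun x hx => ?_) hcr.intervalIntegrable
    rw [norm_mul, hn, one_mul, Complex.norm_real, Real.norm_of_nonneg]
    exact div_nonneg (neg_nonneg.mpr (hneg x (Set.Ioc_subset_Icc_self hx))) (sq_nonneg _)
  have h4 : Complex.I * ∫ x in a..b, (p x : ℂ) * E x = E b * ((q b)⁻¹ : ℝ) - E a * ((q a)⁻¹ : ℝ) -
      ∫ x in a..b, E x * ((-q' x / q x ^ 2 : ℝ) : ℂ) := by rw [← h1]; ring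
  calc ‖∫ x in a..b, (p x : ℂ) * E x‖ = ‖Complex.I * ∫ x in a..b, (p x : ℂ) * E x‖ := by
        rw [norm_mul, Complex.norm_I, one_mul]
    _ ≤ ‖E b * ((q b)⁻¹ : ℝ)‖ + ‖E a * ((q a)⁻¹ : ℝ)‖ +
        ‖∫ x in a..b, E x * ((-q' x / q x ^ 2 : ℝ) : ℂ)‖ := by
        rw [h4]
        exact (norm_sub_le _ _).trans (add_le_add_left (norm_sub_le _ _) _)
    _ ≤ _ := by
        simp only [norm_mul, hn, one_mul, Complex.norm_real, Real.norm_eq_abs, abs_inv]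
        linarith

/-- The cut is a crossing of the level `c`. If `q` stays on one side of `c`, the cut is an endpoint
and one of the two pieces degenerates, which is why each bound is stated as an alternative. -/
theorem exists_level_cut {q : ℝ → ℝ} {a b : ℝ} (hab : a ≤ b) (hq : Continuous q)
    (hanti : AntitoneOn q (Set.Icc a b)) (c : ℝ) :
    ∃ x ∈ Set.Icc a b, (x = a ∨ ∀ y ∈ Set.Icc a x, c ≤ q y) ∧
      (x = b ∨ ∀ y ∈ Set.Icc x b, q y ≤ c) := by
  have ha : a ∈ Set.Icc a b := ⟨le_rfl, hab⟩
  have hb : b ∈ Set.Icc a b := ⟨hab, le_rfl⟩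
  rcases le_total (q a) c with h | h
  · exact ⟨a, ha, Or.inl rfl, Or.inr fun y hy => (hanti ha hy hy.1).trans h⟩
  rcases le_total c (q b) with h' | h'
  · exact ⟨b, hb, Or.inr fun y hy => h'.trans (hanti hy hb hy.2), Or.inl rfl⟩
  obtain ⟨x, hx, rfl⟩ := intermediate_value_Icc' hab hq.continuousOn ⟨h', h⟩
  exact ⟨x, hx, Or.inr fun y hy => hanti ⟨hy.1, hy.2.trans hx.2⟩ hx hy.2,
    Or.inr fun y hy => hanti hx ⟨hx.1.trans hy.1, hy.2⟩ hy.1⟩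

/-- First derivative test combined with the trivial bound near the stationary set. -/
theorem exists_norm_integral_le_of_hasDerivAt_phase {E : ℝ → ℂ} {p q q' : ℝ → ℝ} {a b ε : ℝ}
    (hab : a ≤ b) (hε : 0 < ε) (hp0 : ∀ x, 0 ≤ p x)
    (hE : ∀ x, HasDerivAt E (Complex.I * p x * q x * E x) x) (hn : ∀ x, ‖E x‖ = 1)
    (hq : ∀ x, HasDerivAt q (q' x) x) (hp : Continuous p) (hq' : Continuous q')
    (hneg : ∀ x ∈ Set.Icc a b, q' x ≤ 0) :
    ∃ x y, a ≤ x ∧ x ≤ y ∧ y ≤ b ∧ q x - q y ≤ 2 * ε ∧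
      ‖∫ x in a..b, (p x : ℂ) * E x‖ ≤ 4 / ε + ∫ s in x..y, p s := by
  have hEc : Continuous E := continuous_iff_continuousAt.mpr fun x => (hE x).continuousAt
  have hqc : Continuous q := continuous_iff_continuousAt.mpr fun x => (hq x).continuousAt
  have hcp : Continuous fun x => (p x : ℂ) * E x := (Complex.continuous_ofReal.comp hp).mul hEc
  have hanti : AntitoneOn q (Set.Icc a b) :=
    antitoneOn_of_hasDerivWithinAt_nonpos (convex_Icc a b) hqc.continuousOn
      (fun x _ => (hq x).hasDerivWithinAt) fun x hx => hneg x (interior_subset hx)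
  obtain ⟨x, hx, hx1, hx2⟩ := exists_level_cut hab hqc hanti ε
  obtain ⟨y, hy, hy1, hy2⟩ := exists_level_cut hab hqc hanti (-ε)
  have hxy : x ≤ y := by
    by_contra! hlt
    have h1 := hx1.resolve_left (hy.1.trans_lt hlt).ne' y ⟨hy.1, hlt.le⟩
    have h2 := hy2.resolve_left (hlt.trans_le hx.2).ne y ⟨le_rfl, hy.2⟩
    linarith
  refine ⟨x, y, hx.1, hxy, hy.2, ?_, ?_⟩
  · rcases hxy.eq_or_lt with rfl | hlt
    · linarith
    · have h1 := hx2.resolve_left (hlt.trans_le hy.2).ne x ⟨le_rfl, hx.2⟩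
      have h2 := hy1.resolve_left (hx.1.trans_lt hlt).ne' y ⟨hy.1, le_rfl⟩
      linarith
  -- When `q ≥ ε` throughout, the boundary and variation terms telescope to `2 / q x`; the last
  -- piece, where `q ≤ -ε`, is symmetric.
  · have i1 : ‖∫ s in a..x, (p s : ℂ) * E s‖ ≤ 2 / ε := by
      rcases hx1 with rfl | h
      · simpa using by positivity
      have hpos : ∀ s ∈ Set.Icc a x, 0 < q s := fun s hs => hε.trans_le (h s hs)
      refine (norm_integral_le_of_hasDerivAt_phase hx.1 hE hn hq hp hq'
        (fun s hs => hneg s ⟨hs.1, hs.2.trans hx.2⟩) fun s hs => (hpos s hs).ne').trans ?_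
      rw [abs_of_pos (hpos a ⟨le_rfl, hx.1⟩), abs_of_pos (hpos x ⟨hx.1, le_rfl⟩)]
      have := inv_anti₀ hε (h x ⟨hx.1, le_rfl⟩)
      rw [div_eq_mul_inv]
      linarith
    have i3 : ‖∫ s in y..b, (p s : ℂ) * E s‖ ≤ 2 / ε := by
      rcases hy2 with rfl | h
      · simpa using by positivity
      have hpos : ∀ s ∈ Set.Icc y b, q s < 0 := fun s hs => (h s hs).trans_lt (by linarith)
      refine (norm_integral_le_of_hasDerivAt_phase hy.2 hE hn hq hp hq'
        (fun s hs => hneg s ⟨hy.1.trans hs.1, hs.2⟩) fun s hs => (hpos s hs).ne).trans ?_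
      rw [abs_of_neg (hpos y ⟨le_rfl, hy.2⟩), abs_of_neg (hpos b ⟨hy.2, le_rfl⟩)]
      have := inv_anti₀ hε (le_neg_of_le_neg (h y ⟨le_rfl, hy.2⟩))
      rw [div_eq_mul_inv]
      rw [inv_neg] at this ⊢
      rw [inv_neg]
      linarith
    have i2 : ‖∫ s in x..y, (p s : ℂ) * E s‖ ≤ ∫ s in x..y, p s := by
      refine intervalIntegral.norm_integral_le_of_norm_le hxy
        (MeasureTheory.ae_of_all _ fun s _ => ?_) (hp.intervalIntegrable _ _)
      rw [norm_mul, hn, mul_one, Complex.norm_real, Real.norm_of_nonneg (hp0 s)]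
    rw [← intervalIntegral.integral_add_adjacent_intervals (hcp.intervalIntegrable a y)
      (hcp.intervalIntegrable y b), ← intervalIntegral.integral_add_adjacent_intervals
      (hcp.intervalIntegrable a x) (hcp.intervalIntegrable x y)]
    refine (norm_add_le _ _).trans ((add_le_add_left (norm_add_le _ _) _).trans ?_)
    have : 4 / ε = 2 / ε + 2 / ε := by ring
    linarith

/-! ### The distance function `|r - t e^{iθ}|` for `r² = 1 + t²` -/

/-- The distance `|r - t e^{iθ}|`. -/
def chord (r t θ : ℝ) : ℝ := √(r ^ 2 + t ^ 2 - 2 * r * t * Real.cos θ)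

section Chord

variable {r t : ℝ}

theorem chord_sq_pos (ht : 0 < t) (hr : 0 < r) (hrt : r ^ 2 = 1 + t ^ 2) (θ : ℝ) :
    0 < r ^ 2 + t ^ 2 - 2 * r * t * Real.cos θ := by
  have h1 : r * t * Real.cos θ ≤ r * t * 1 :=
    mul_le_mul_of_nonneg_left (Real.cos_le_one θ) (by positivity)
  have : r ≠ t := by rintro rfl; linarith
  have := sq_pos_of_ne_zero (sub_ne_zero.mpr this)
  nlinarith

theorem chord_pos (ht : 0 < t) (hr : 0 < r) (hrt : r ^ 2 = 1 + t ^ 2) (θ : ℝ) : 0 < chord r t θ :=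
  Real.sqrt_pos.mpr (chord_sq_pos ht hr hrt θ)

theorem chord_sq (ht : 0 < t) (hr : 0 < r) (hrt : r ^ 2 = 1 + t ^ 2) (θ : ℝ) :
    chord r t θ ^ 2 = r ^ 2 + t ^ 2 - 2 * r * t * Real.cos θ :=
  Real.sq_sqrt (chord_sq_pos ht hr hrt θ).le

theorem continuous_chord : Continuous (chord r t) := by
  unfold chord
  fun_prop

theorem hasDerivAt_chord (ht : 0 < t) (hr : 0 < r) (hrt : r ^ 2 = 1 + t ^ 2) (θ : ℝ) :
    HasDerivAt (chord r t) (r * t * Real.sin θ / chord r t θ) θ := by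
  have h1 : HasDerivAt (fun θ => r ^ 2 + t ^ 2 - 2 * r * t * Real.cos θ)
      (-(2 * r * t * -Real.sin θ)) θ :=
    ((Real.hasDerivAt_cos θ).const_mul (2 * r * t)).const_sub (r ^ 2 + t ^ 2)
  refine (h1.sqrt (chord_sq_pos ht hr hrt θ).ne').congr_deriv ?_
  change _ / (2 * chord r t θ) = _
  have := chord_pos ht hr hrt θ
  field_simp

theorem sub_mul_add_eq_one (hrt : r ^ 2 = 1 + t ^ 2) : (r - t) * (r + t) = 1 := by
  linear_combination hrt

theorem chord_le (ht : 0 < t) (hr : 0 < r) (hrt : r ^ 2 = 1 + t ^ 2) (θ : ℝ) :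
    chord r t θ ≤ r + t := by
  refine abs_le_of_sq_le_sq' ?_ (by positivity) |>.2
  rw [chord_sq ht hr hrt]
  have h1 : r * t * (-1) ≤ r * t * Real.cos θ :=
    mul_le_mul_of_nonneg_left (Real.neg_one_le_cos θ) (by positivity)
  nlinarith

/-- The reverse triangle inequality gives `chord ≥ r - t`, and `r - t = 1/(r + t)`. -/
theorem one_le_mul_chord (ht : 0 < t) (hr : 0 < r) (hrt : r ^ 2 = 1 + t ^ 2) (θ : ℝ) :
    1 ≤ (r + t) * chord r t θ := by
  have hlt : t < r := by nlinarith
  have h : r - t ≤ chord r t θ := by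
    refine abs_le_of_sq_le_sq' ?_ (chord_pos ht hr hrt θ).le |>.2
    rw [chord_sq ht hr hrt]
    have h1 : r * t * Real.cos θ ≤ r * t * 1 :=
      mul_le_mul_of_nonneg_left (Real.cos_le_one θ) (by positivity)
    nlinarith
  have := mul_le_mul_of_nonneg_left h (by positivity : 0 ≤ r + t)
  linarith [sub_mul_add_eq_one hrt, mul_comm (r + t) (r - t)]

/-- The extreme values of the chord are `R = r + t` at `θ = π` and `1/R` at `θ = 0`, where the sine
vanishes; the factors on the right exhibit these zeros. -/
theorem four_mul_sin_sq (ht : 0 < t) (hr : 0 < r) (hrt : r ^ 2 = 1 + t ^ 2) (θ : ℝ) :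
    4 * (r * t * Real.sin θ) ^ 2 * (r + t) ^ 2 =
      ((r + t) ^ 2 - chord r t θ ^ 2) * ((r + t) ^ 2 * chord r t θ ^ 2 - 1) := by
  have h1 := sub_mul_add_eq_one hrt
  have h2 : (1 : ℝ) = (r - t) ^ 2 * (r + t) ^ 2 := by rw [← mul_pow, h1, one_pow]
  rw [chord_sq ht hr hrt, mul_pow, Real.sin_sq]
  linear_combination ((r + t) ^ 2 - (r ^ 2 + t ^ 2 - 2 * r * t * Real.cos θ)) * h2

theorem one_sub_exp_neg_ge {x : ℝ} (hx : 0 < x) : x / (1 + x) ≤ 1 - Real.exp (-x) := by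
  have h1 : Real.exp (-x) ≤ 1 / (1 + x) := by
    rw [Real.exp_neg, ← one_div]
    exact one_div_le_one_div_of_le (by linarith) (by linarith [Real.add_one_le_exp x])
  have h2 : x / (1 + x) = 1 - 1 / (1 + x) := by field_simp; ring
  linarith

/-- Rests on `(1 + x)/x = 1 + 1/x ≤ (1 + 1/√x)²`. -/
theorem le_mul_one_add_inv_sqrt {w s A x : ℝ} (hs : 0 ≤ s) (hA : 0 ≤ A) (hx : 0 < x)
    (h : w ^ 2 * (x / (1 + x)) ≤ A * s ^ 2) : w ≤ s * (√A * (1 + (√x)⁻¹)) := by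
  refine abs_le_of_sq_le_sq' ?_ (by positivity) |>.2
  have hsx : 0 < √x := Real.sqrt_pos.mpr hx
  have h1 : (1 + x) / x ≤ (1 + (√x)⁻¹) ^ 2 := by
    have h2 : ((√x)⁻¹) ^ 2 = x⁻¹ := by rw [inv_pow, Real.sq_sqrt hx.le]
    have h3 : (1 + x) / x = 1 + x⁻¹ := by field_simp; ring
    have : 0 < (√x)⁻¹ := inv_pos.mpr hsx
    rw [h3, ← h2]
    nlinarith
  have h4 : w ^ 2 = w ^ 2 * (x / (1 + x)) * ((1 + x) / x) := by field_simp
  calc w ^ 2 = w ^ 2 * (x / (1 + x)) * ((1 + x) / x) := h4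
    _ ≤ A * s ^ 2 * (1 + (√x)⁻¹) ^ 2 :=
      mul_le_mul h h1 (by positivity) (by positivity)
    _ = (s * (√A * (1 + (√x)⁻¹))) ^ 2 := by
      rw [mul_pow, mul_pow, Real.sq_sqrt hA]; ring

/-- Pointwise lower bound for the derivative of `log (chord r t)`. -/
theorem chord_le_mul_sin (ht : 0 < t) (hr : 0 < r) (hrt : r ^ 2 = 1 + t ^ 2) {θ : ℝ}
    (hθ : θ ∈ Set.Ioo 0 Real.pi) :
    0 < Real.log (r + t) + Real.log (chord r t θ) ∧
    0 < Real.log (r + t) - Real.log (chord r t θ) ∧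
    chord r t θ ≤ r * t * Real.sin θ * (√(2 / (t * (r + t))) *
      (1 + (√(2 * (Real.log (r + t) + Real.log (chord r t θ))))⁻¹ +
        (√(2 * (Real.log (r + t) - Real.log (chord r t θ))))⁻¹)) := by
  have hσ := chord_pos ht hr hrt θ
  have hR : 0 < r + t := by positivity
  have hsin : 0 < r * t * Real.sin θ := by
    have := Real.sin_pos_of_mem_Ioo hθ
    positivity
  have hid := four_mul_sin_sq ht hr hrt θ
  have h1 := chord_le ht hr hrt θ
  have h2 := one_le_mul_chord ht hr hrt θ
  set σ := chord r t θ with hσdef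
  set s := r * t * Real.sin θ
  set R := r + t with hRdef
  have hR2 : R ^ 2 - 1 = 2 * t * R := by rw [hRdef]; linear_combination hrt
  have hprod : 0 < (R ^ 2 - σ ^ 2) * (R ^ 2 * σ ^ 2 - 1) := by rw [← hid]; positivity
  have ha : 0 ≤ R ^ 2 - σ ^ 2 := by nlinarith
  have hb : 0 ≤ R ^ 2 * σ ^ 2 - 1 := by nlinarith
  have ha' : 0 < R ^ 2 - σ ^ 2 := lt_of_le_of_ne ha fun h => by
    rw [← h, zero_mul] at hprod
    exact lt_irrefl _ hprod
  have hb' : 0 < R ^ 2 * σ ^ 2 - 1 := lt_of_le_of_ne hb fun h => by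
    rw [← h, mul_zero] at hprod
    exact lt_irrefl _ hprod
  have hσR : σ < R := by nlinarith
  have hσR' : 1 < R * σ := by nlinarith
  have hh : 0 < Real.log R + Real.log σ := by
    rw [← Real.log_mul hR.ne' hσ.ne']
    exact Real.log_pos hσR'
  have hk : 0 < Real.log R - Real.log σ := sub_pos.mpr (Real.log_lt_log hσ hσR)
  refine ⟨hh, hk, ?_⟩
  have hA : 0 ≤ 2 / (t * R) := by positivity
  -- Only one factor of `four_mul_sin_sq` can degenerate on each side of `σ = 1`. For `σ ≤ 1` the
  -- other obeys `R² - σ² ≥ R² - 1 = 2tR`; for `σ ≥ 1` it obeys `R²σ² - 1 ≥ σ²(R² - 1)`.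
  rcases le_total σ 1 with hle | hle
  · have he : Real.exp (-(2 * (Real.log R + Real.log σ))) = 1 / (R ^ 2 * σ ^ 2) := by
      rw [Real.exp_neg, mul_comm 2, Real.exp_mul, Real.exp_add, Real.exp_log hR, Real.exp_log hσ]
      norm_num [mul_pow]
    have hx := one_sub_exp_neg_ge (x := 2 * (Real.log R + Real.log σ)) (by positivity)
    rw [he] at hx
    have key : σ ^ 2 * (1 - 1 / (R ^ 2 * σ ^ 2)) ≤ 2 / (t * R) * s ^ 2 := by
      have e1 : 2 / (t * R) * s ^ 2 =
          (R ^ 2 - σ ^ 2) * (R ^ 2 * σ ^ 2 - 1) / (2 * t * R * R ^ 2) := by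
        rw [← hid]; field_simp; ring
      have e2 : σ ^ 2 * (1 - 1 / (R ^ 2 * σ ^ 2)) =
          (R ^ 2 - 1) * (R ^ 2 * σ ^ 2 - 1) / (2 * t * R * R ^ 2) := by
        rw [hR2]; field_simp
      rw [e1, e2]
      gcongr
      nlinarith
    have := le_mul_one_add_inv_sqrt hsin.le hA
      (x := 2 * (Real.log R + Real.log σ)) (by positivity)
      ((mul_le_mul_of_nonneg_left hx (sq_nonneg σ)).trans key)
    refine this.trans (mul_le_mul_of_nonneg_left (mul_le_mul_of_nonneg_left ?_
      (Real.sqrt_nonneg _)) hsin.le)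
    have : 0 ≤ (√(2 * (Real.log R - Real.log σ)))⁻¹ := by positivity
    linarith
  · have he : Real.exp (-(2 * (Real.log R - Real.log σ))) = σ ^ 2 / R ^ 2 := by
      rw [Real.exp_neg, mul_comm 2, Real.exp_mul, Real.exp_sub, Real.exp_log hR, Real.exp_log hσ]
      norm_num [div_pow]
    have hx := one_sub_exp_neg_ge (x := 2 * (Real.log R - Real.log σ)) (by positivity)
    rw [he] at hx
    have key : σ ^ 2 * (1 - σ ^ 2 / R ^ 2) ≤ 2 / (t * R) * s ^ 2 := by
      have e1 : 2 / (t * R) * s ^ 2 =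
          (R ^ 2 - σ ^ 2) * (R ^ 2 * σ ^ 2 - 1) / (2 * t * R * R ^ 2) := by
        rw [← hid]; field_simp; ring
      have e2 : σ ^ 2 * (1 - σ ^ 2 / R ^ 2) =
          (R ^ 2 - σ ^ 2) * (σ ^ 2 * (R ^ 2 - 1)) / (2 * t * R * R ^ 2) := by
        rw [hR2]; field_simp
      rw [e1, e2]
      gcongr
      nlinarith
    have := le_mul_one_add_inv_sqrt hsin.le hA
      (x := 2 * (Real.log R - Real.log σ)) (by positivity)
      ((mul_le_mul_of_nonneg_left hx (sq_nonneg σ)).trans key)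
    refine this.trans (mul_le_mul_of_nonneg_left (mul_le_mul_of_nonneg_left ?_
      (Real.sqrt_nonneg _)) hsin.le)
    have : 0 ≤ (√(2 * (Real.log R + Real.log σ)))⁻¹ := by positivity
    linarith

theorem sqrt_sub_sqrt_le {x y : ℝ} (hx : 0 ≤ x) (hxy : x ≤ y) : √y - √x ≤ √(y - x) := by
  rw [sub_le_iff_le_add, Real.sqrt_le_iff]
  refine ⟨by positivity, ?_⟩
  nlinarith [Real.sq_sqrt hx, Real.sq_sqrt (sub_nonneg.mpr hxy),
    mul_nonneg (Real.sqrt_nonneg (y - x)) (Real.sqrt_nonneg x)]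

/-- Length estimate: the integral of `1 / chord` is controlled by the increment of
`log (chord r t)`. -/
theorem integral_inv_chord_le (ht : 0 < t) (hr : 0 < r) (hrt : r ^ 2 = 1 + t ^ 2) {x y : ℝ}
    (hx : 0 ≤ x) (hxy : x ≤ y) (hy : y ≤ Real.pi)
    (hmono : Real.log (chord r t x) ≤ Real.log (chord r t y)) :
    ∫ θ in x..y, (chord r t θ)⁻¹ ≤ √(2 / (t * (r + t))) *
      ((Real.log (chord r t y) - Real.log (chord r t x)) +
        2 * √(2 * (Real.log (chord r t y) - Real.log (chord r t x)))) := by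
  set h : ℝ → ℝ := fun θ => Real.log (r + t) + Real.log (chord r t θ) with hh
  set k : ℝ → ℝ := fun θ => Real.log (r + t) - Real.log (chord r t θ) with hk
  have hR : 0 < r + t := by positivity
  have hlogc : Continuous fun θ => Real.log (chord r t θ) :=
    continuous_chord.log fun θ => (chord_pos ht hr hrt θ).ne'
  have hh0 : ∀ θ, 0 ≤ h θ := fun θ => by
    simp only [hh]
    rw [← Real.log_mul hR.ne' (chord_pos ht hr hrt θ).ne']
    exact Real.log_nonneg (one_le_mul_chord ht hr hrt θ)
  have hk0 : ∀ θ, 0 ≤ k θ := fun θ =>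
    sub_nonneg.mpr (Real.log_le_log (chord_pos ht hr hrt θ) (chord_le ht hr hrt θ))
  -- This function is the primitive of the bound in `chord_le_mul_sin` times `(log chord)' /
  -- chord`'s numerator-free factor, since `h' = -k' = (log chord)'`. Its derivative may blow up at
  -- `0` and `π`, so only continuity is used at the ends.
  have hc : Continuous fun θ => √(2 / (t * (r + t))) * (h θ + √(2 * h θ) - √(2 * k θ)) := by
    fun_prop
  have hle := intervalIntegral.integral_le_sub_of_hasDeriv_right_of_le
    (φ := fun θ => (chord r t θ)⁻¹)
    (g := fun θ => √(2 / (t * (r + t))) * (h θ + √(2 * h θ) - √(2 * k θ)))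
    (g' := fun θ => (r * t * Real.sin θ / chord r t θ / chord r t θ) * (√(2 / (t * (r + t))) *
      (1 + (√(2 * h θ))⁻¹ + (√(2 * k θ))⁻¹))) hxy hc.continuousOn (fun θ hθ => ?_)
    ((continuous_chord.inv₀ fun θ => (chord_pos ht hr hrt θ).ne').integrableOn_Icc)
    (fun θ hθ => ?_)
  · refine hle.trans ?_
    rw [← mul_sub]
    refine mul_le_mul_of_nonneg_left ?_ (Real.sqrt_nonneg _)
    have h1 := sqrt_sub_sqrt_le (x := 2 * h x) (y := 2 * h y) (by linarith [hh0 x])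
      (by simp only [hh]; linarith)
    have h2 := sqrt_sub_sqrt_le (x := 2 * k y) (y := 2 * k x) (by linarith [hk0 y])
      (by simp only [hk]; linarith)
    have e1 : 2 * h y - 2 * h x = 2 * (Real.log (chord r t y) - Real.log (chord r t x)) := by
      simp only [hh]; ring
    have e2 : 2 * k x - 2 * k y = 2 * (Real.log (chord r t y) - Real.log (chord r t x)) := by
      simp only [hk]; ring
    have e3 : h y - h x = Real.log (chord r t y) - Real.log (chord r t x) := by
      simp only [hh]; ring
    rw [e1] at h1
    rw [e2] at h2
    linarith
  · have hθ' : θ ∈ Set.Ioo 0 Real.pi := ⟨hx.trans_lt hθ.1, hθ.2.trans_le hy⟩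
    obtain ⟨p1, p2, -⟩ := chord_le_mul_sin ht hr hrt hθ'
    have hσ := chord_pos ht hr hrt θ
    have dl : HasDerivAt (fun θ => Real.log (chord r t θ))
        (r * t * Real.sin θ / chord r t θ / chord r t θ) θ :=
      (hasDerivAt_chord ht hr hrt θ).log hσ.ne'
    have dh : HasDerivAt h (r * t * Real.sin θ / chord r t θ / chord r t θ) θ := dl.const_add _
    have dk : HasDerivAt k (-(r * t * Real.sin θ / chord r t θ / chord r t θ)) θ := dl.const_sub _
    have q1 : 2 * h θ ≠ 0 := by simp only [hh]; positivity
    have q2 : 2 * k θ ≠ 0 := by simp only [hk]; positivity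
    have := ((dh.add ((dh.const_mul 2).sqrt q1)).sub ((dk.const_mul 2).sqrt q2)).const_mul
      (√(2 / (t * (r + t))))
    refine (this.congr_deriv ?_).hasDerivWithinAt
    ring
  · have hθ' : θ ∈ Set.Ioo 0 Real.pi := ⟨hx.trans_lt hθ.1, hθ.2.trans_le hy⟩
    obtain ⟨p1, p2, hb⟩ := chord_le_mul_sin ht hr hrt hθ'
    have hσ := chord_pos ht hr hrt θ
    have : (chord r t θ)⁻¹ = chord r t θ / chord r t θ / chord r t θ := by field_simp
    rw [this, div_mul_eq_mul_div, div_mul_eq_mul_div]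
    gcongr

end Chord

/-! ### The kernel as an oscillatory integral -/

/-- The unimodular factor of the boundary values of `z⁻ⁿ (rz - t)^m / (r - tz)^(m+1)`. -/
def phase (r t : ℝ) (n m : ℕ) (θ : ℝ) : ℂ :=
  Complex.exp (-(n * θ) * Complex.I) * (chord r t θ / (r - t * Complex.exp (θ * Complex.I))) *
    ((r * Complex.exp (θ * Complex.I) - t) / (r - t * Complex.exp (θ * Complex.I))) ^ m

section Phase

variable {r t : ℝ}

theorem hasDerivAt_exp_mul_I (θ : ℝ) :
    HasDerivAt (fun θ : ℝ => Complex.exp (θ * Complex.I))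
      (Complex.I * Complex.exp (θ * Complex.I)) θ := by
  have h : HasDerivAt (fun θ : ℝ => (θ : ℂ) * Complex.I) Complex.I θ := by
    simpa using (Complex.ofRealCLM.hasDerivAt (x := θ)).mul_const Complex.I
  simpa [mul_comm] using h.cexp

theorem mul_conj_eq_chord_sq (ht : 0 < t) (hr : 0 < r) (hrt : r ^ 2 = 1 + t ^ 2) (θ : ℝ) :
    (r - t * Complex.exp (θ * Complex.I)) * (r - t * Complex.exp (-(θ * Complex.I))) =
      (chord r t θ : ℂ) ^ 2 := by
  have h1 : Complex.exp (θ * Complex.I) * Complex.exp (-(θ * Complex.I)) = 1 := by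
    rw [← Complex.exp_add, add_neg_cancel, Complex.exp_zero]
  have h2 : Complex.exp (θ * Complex.I) + Complex.exp (-(θ * Complex.I)) = 2 * Complex.cos θ := by
    rw [Complex.two_cos, neg_mul]
  have h3 : (chord r t θ : ℂ) ^ 2 = (r : ℂ) ^ 2 + t ^ 2 - 2 * r * t * Complex.cos θ := by
    exact_mod_cast congrArg (fun x : ℝ => (x : ℂ)) (chord_sq ht hr hrt θ)
  rw [h3]
  linear_combination (t : ℂ) ^ 2 * h1 - r * t * h2

theorem sub_exp_ne_zero (ht : 0 < t) (hr : 0 < r) (hrt : r ^ 2 = 1 + t ^ 2) (θ : ℝ) :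
    (r - t * Complex.exp (θ * Complex.I) : ℂ) ≠ 0 := by
  intro h
  have := mul_conj_eq_chord_sq ht hr hrt θ
  rw [h, zero_mul] at this
  exact (pow_ne_zero 2 (Complex.ofReal_ne_zero.mpr (chord_pos ht hr hrt θ).ne')) this.symm

/-- The logarithmic derivatives of the three factors are `-in`, `i(1/(2σ²) - 1/2)` and `im/σ²`, with
`σ` the chord. The middle one, from normalising `1/(r - t e^{iθ})`, produces both halves in the
frequency. -/
theorem hasDerivAt_phase (ht : 0 < t) (hr : 0 < r) (hrt : r ^ 2 = 1 + t ^ 2) (n m : ℕ) (θ : ℝ) :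
    HasDerivAt (phase r t n m) (Complex.I * ((chord r t θ)⁻¹ : ℝ) *
      (((m : ℝ) + 1 / 2) * (chord r t θ)⁻¹ - ((n : ℝ) + 1 / 2) * chord r t θ : ℝ) *
        phase r t n m θ) θ := by
  have hX := sub_exp_ne_zero ht hr hrt θ
  have hσ : (chord r t θ : ℂ) ≠ 0 := Complex.ofReal_ne_zero.mpr (chord_pos ht hr hrt θ).ne'
  have hmc := mul_conj_eq_chord_sq ht hr hrt θ
  have hζ := hasDerivAt_exp_mul_I θ
  have hrt' : (r : ℂ) ^ 2 = 1 + t ^ 2 := by exact_mod_cast hrt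
  have h1 : Complex.exp (θ * Complex.I) * Complex.exp (-(θ * Complex.I)) = 1 := by
    rw [← Complex.exp_add, add_neg_cancel, Complex.exp_zero]
  have hcs : Complex.exp (θ * Complex.I) = Complex.cos θ + Complex.sin θ * Complex.I :=
    Complex.exp_mul_I _
  have hchord2 : (chord r t θ : ℂ) ^ 2 = (r : ℂ) ^ 2 + t ^ 2 - 2 * r * t * Complex.cos θ := by
    exact_mod_cast congrArg (fun x : ℝ => (x : ℂ)) (chord_sq ht hr hrt θ)
  have hXd : HasDerivAt (fun θ : ℝ => (r - t * Complex.exp (θ * Complex.I) : ℂ))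
      (-(t * (Complex.I * Complex.exp (θ * Complex.I)))) θ := (hζ.const_mul (t : ℂ)).const_sub _
  have hZd : HasDerivAt (fun θ : ℝ => (r * Complex.exp (θ * Complex.I) - t : ℂ))
      (r * (Complex.I * Complex.exp (θ * Complex.I))) θ := (hζ.const_mul (r : ℂ)).sub_const _
  have hB : HasDerivAt (fun θ : ℝ => ((r * Complex.exp (θ * Complex.I) - t) /
        (r - t * Complex.exp (θ * Complex.I)) : ℂ))
      (Complex.I / (chord r t θ) ^ 2 * ((r * Complex.exp (θ * Complex.I) - t) /
        (r - t * Complex.exp (θ * Complex.I)))) θ := by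
    refine (hZd.div hXd hX).congr_deriv ?_
    rw [div_mul_div_comm, div_eq_div_iff (pow_ne_zero 2 hX)
      (mul_ne_zero (pow_ne_zero 2 hσ) hX), ← hmc]
    generalize Complex.exp (θ * Complex.I) = z at *
    generalize Complex.exp (-(θ * Complex.I)) = w at *
    linear_combination Complex.I * (r - t * z) ^ 2 * (z * (r - t * w)) * hrt' -
      Complex.I * (r - t * z) ^ 2 * t * h1
  have hC : HasDerivAt (fun θ : ℝ => (chord r t θ / (r - t * Complex.exp (θ * Complex.I)) : ℂ))
      (Complex.I * (1 / 2 / (chord r t θ) ^ 2 - 1 / 2) *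
        (chord r t θ / (r - t * Complex.exp (θ * Complex.I)))) θ := by
    refine ((hasDerivAt_chord ht hr hrt θ).ofReal_comp.div hXd hX).congr_deriv ?_
    have e1 : Complex.I * (1 / 2 / (chord r t θ : ℂ) ^ 2 - 1 / 2) *
        (chord r t θ / (r - t * Complex.exp (θ * Complex.I))) =
        Complex.I * (1 - (chord r t θ : ℂ) ^ 2) * (r - t * Complex.exp (θ * Complex.I)) /
          (2 * chord r t θ * (r - t * Complex.exp (θ * Complex.I)) ^ 2) := by
      field_simp
    rw [e1]
    push_cast
    rw [div_eq_div_iff (pow_ne_zero 2 hX)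
      (mul_ne_zero (mul_ne_zero two_ne_zero hσ) (pow_ne_zero 2 hX))]
    generalize Complex.exp (θ * Complex.I) = z at *
    generalize Complex.exp (-(θ * Complex.I)) = w at *
    field_simp
    linear_combination (-2 * Complex.I * t * z) * hmc - 2 * Complex.I * t ^ 2 * (r - t * z) * h1 +
      2 * Complex.I * r * t * (r - t * z) * hcs + (r - t * z) * Complex.I * hchord2 +
      (r - t * z) * 2 * r * t * Complex.sin θ * Complex.I_sq + (r - t * z) * Complex.I * hrt'
  have hA : HasDerivAt (fun θ : ℝ => Complex.exp (-(n * θ) * Complex.I))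
      (-(n * Complex.I) * Complex.exp (-(n * θ) * Complex.I)) θ := by
    have h : HasDerivAt (fun θ : ℝ => -((n : ℂ) * (θ : ℂ)) * Complex.I) (-(n * Complex.I)) θ := by
      simpa using (((Complex.ofRealCLM.hasDerivAt (x := θ)).const_mul (n : ℂ)).neg.mul_const
        Complex.I)
    simpa [mul_comm] using h.cexp
  have hBm : HasDerivAt (fun θ : ℝ => ((r * Complex.exp (θ * Complex.I) - t) /
        (r - t * Complex.exp (θ * Complex.I)) : ℂ) ^ m)
      (m * (Complex.I / (chord r t θ) ^ 2) * ((r * Complex.exp (θ * Complex.I) - t) /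
        (r - t * Complex.exp (θ * Complex.I))) ^ m) θ := by
    refine (hB.pow m).congr_deriv ?_
    rcases m with _ | m
    · simp
    · rw [Nat.add_sub_cancel, pow_succ]; ring
  refine ((hA.mul hC).mul hBm).congr_deriv ?_
  simp only [phase, Pi.mul_apply]
  push_cast
  field_simp
  ring

theorem norm_phase (ht : 0 < t) (hr : 0 < r) (hrt : r ^ 2 = 1 + t ^ 2) (n m : ℕ) (θ : ℝ) :
    ‖phase r t n m θ‖ = 1 := by
  have hσ := chord_pos ht hr hrt θ
  have hmc := mul_conj_eq_chord_sq ht hr hrt θ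
  have hcj : (r - t * Complex.exp (-(θ * Complex.I)) : ℂ) =
      conj (r - t * Complex.exp (θ * Complex.I) : ℂ) := by
    simp [← Complex.exp_conj]
  have hX : ‖(r - t * Complex.exp (θ * Complex.I) : ℂ)‖ = chord r t θ := by
    rw [hcj, Complex.mul_conj, Complex.normSq_eq_norm_sq] at hmc
    have : ‖(r - t * Complex.exp (θ * Complex.I) : ℂ)‖ ^ 2 = chord r t θ ^ 2 := by
      exact_mod_cast hmc
    exact (pow_left_inj₀ (norm_nonneg _) hσ.le two_ne_zero).mp this
  have hZ : ‖(r * Complex.exp (θ * Complex.I) - t : ℂ)‖ = chord r t θ := by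
    have h1 : (r * Complex.exp (θ * Complex.I) - t : ℂ) =
        Complex.exp (θ * Complex.I) * (r - t * Complex.exp (-(θ * Complex.I))) := by
      have : Complex.exp (θ * Complex.I) * Complex.exp (-(θ * Complex.I)) = 1 := by
        rw [← Complex.exp_add, add_neg_cancel, Complex.exp_zero]
      linear_combination (t : ℂ) * this
    rw [h1, norm_mul, Complex.norm_exp_ofReal_mul_I, one_mul, hcj, RCLike.norm_conj, hX]
  have hn : ‖Complex.exp (-(n * θ) * Complex.I)‖ = 1 := by
    have := Complex.norm_exp_ofReal_mul_I (-(n * θ))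
    push_cast at this
    exact this
  rw [phase, norm_mul, norm_mul, norm_pow, norm_div, norm_div, hX, hZ, hn, Complex.norm_real,
    Real.norm_of_nonneg hσ.le, div_self hσ.ne']
  simp

theorem phase_neg (n m : ℕ) (θ : ℝ) : phase r t n m (-θ) = conj (phase r t n m θ) := by
  simp [phase, chord, ← Complex.exp_conj]

theorem chord_neg (θ : ℝ) : chord r t (-θ) = chord r t θ := by simp [chord]

theorem continuous_phase (ht : 0 < t) (hr : 0 < r) (hrt : r ^ 2 = 1 + t ^ 2) (n m : ℕ) :
    Continuous (phase r t n m) :=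
  continuous_iff_continuousAt.mpr fun θ => (hasDerivAt_phase ht hr hrt n m θ).continuousAt

/-- Increment of `M / x - N x` in terms of the increment of `log x`. -/
theorem mul_log_sub_log_le {M N a b : ℝ} (hM : 0 ≤ M) (hN : 0 ≤ N) (ha : 0 < a) (hab : a ≤ b) :
    (M * (√(a * b))⁻¹ + N * √(a * b)) * (Real.log b - Real.log a) ≤
      (M * a⁻¹ - N * a) - (M * b⁻¹ - N * b) := by
  have hb : 0 < b := ha.trans_le hab
  set g := √(a * b) with hg
  have hgpos : 0 < g := Real.sqrt_pos.mpr (by positivity)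
  have hg2 : g ^ 2 = a * b := Real.sq_sqrt (by positivity)
  -- The logarithmic mean dominates the geometric mean: this is `x ≤ sinh x` at half the increment
  -- of the logarithm.
  have hlog : Real.log b - Real.log a ≤ (b - a) / g := by
    have h1 : Real.log g = (Real.log a + Real.log b) / 2 := by
      rw [hg, Real.log_sqrt (by positivity), Real.log_mul ha.ne' hb.ne']
    have h2 : (Real.log b - Real.log a) / 2 ≤ Real.sinh ((Real.log b - Real.log a) / 2) :=
      Real.self_le_sinh_iff.mpr (by linarith [Real.log_le_log ha hab])
    have h3 : Real.sinh ((Real.log b - Real.log a) / 2) = (b - a) / g / 2 := by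
      rw [Real.sinh_eq, show (Real.log b - Real.log a) / 2 = Real.log b - Real.log g by linarith,
        neg_sub, show Real.log g - Real.log b = Real.log a - Real.log g by linarith,
        Real.exp_sub, Real.exp_sub, Real.exp_log ha, Real.exp_log hb, Real.exp_log hgpos]
      ring
    linarith
  have h1 : (M * a⁻¹ - N * a) - (M * b⁻¹ - N * b) = (M * g⁻¹ + N * g) * ((b - a) / g) := by
    have : a⁻¹ - b⁻¹ = (b - a) / g ^ 2 := by rw [hg2]; field_simp
    have h2 : (M * a⁻¹ - N * a) - (M * b⁻¹ - N * b) = M * (a⁻¹ - b⁻¹) + N * (b - a) := by ring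
    rw [h2, this]
    field_simp
  rw [h1]
  exact mul_le_mul_of_nonneg_left hlog (by positivity)

/-- Final optimization of the constants; `l ^ 4` plays the role of `n + m + 1`. -/
theorem length_bound {t R l Δ ε : ℝ} (ht : 0 < t) (hR : 2 * t ≤ R) (hl : 0 < l) (hΔ : 0 ≤ Δ)
    (hε : ε = √t * l) (h1 : l ^ 2 * Δ ≤ 2 * ε) (h2 : l ^ 4 / R * Δ ≤ 2 * ε) :
    √(2 / (t * R)) * (Δ + 2 * √(2 * Δ)) ≤ 8 / (√t * l) := by
  have hτ : 0 < √t := Real.sqrt_pos.mpr ht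
  have hτ2 : √t ^ 2 = t := Real.sq_sqrt ht.le
  have hRpos : 0 < R := by linarith
  have e1 : √(2 / (t * R)) ≤ 1 / t := by
    rw [Real.sqrt_le_iff]
    refine ⟨by positivity, ?_⟩
    rw [div_pow, one_pow, div_le_div_iff₀ (by positivity) (by positivity)]
    nlinarith
  have f1 : √(2 / (t * R)) * Δ ≤ 2 / (√t * l) := by
    have : Δ ≤ 2 * √t / l := by
      rw [le_div_iff₀ hl]
      have : (Δ * l) * l ≤ (2 * √t) * l := by rw [hε] at h1; linarith
      exact le_of_mul_le_mul_right this hl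
    calc √(2 / (t * R)) * Δ ≤ 1 / t * (2 * √t / l) := mul_le_mul e1 this hΔ (by positivity)
      _ = 2 / (√t * l) := by
        nth_rewrite 1 [← hτ2]
        field_simp
  have f2 : √(2 / (t * R)) * (2 * √(2 * Δ)) ≤ 6 / (√t * l) := by
    -- Multiplying the two hypotheses on `Δ` gives `(Δ l²)² ≤ 4tR`, and `2t ≤ R`.
    have g1 : Δ * l ^ 2 ≤ 2 * R := by
      refine abs_le_of_sq_le_sq' ?_ (by positivity) |>.2
      have h3 : l ^ 4 * Δ ≤ 2 * ε * R := by
        rwa [div_mul_eq_mul_div, div_le_iff₀ hRpos] at h2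
      have h4 : (l ^ 2 * Δ) * (l ^ 4 * Δ) ≤ (2 * ε) * (2 * ε * R) :=
        mul_le_mul h1 h3 (by positivity) (by rw [hε]; positivity)
      have h5 : (2 * ε) * (2 * ε * R) = (4 * t * R) * l ^ 2 := by
        rw [hε]; linear_combination 4 * l ^ 2 * R * hτ2
      have h6 : (Δ * l ^ 2) ^ 2 * l ^ 2 ≤ (4 * t * R) * l ^ 2 := by
        rw [← h5]; linarith
      have h7 := le_of_mul_le_mul_right h6 (by positivity)
      nlinarith
    have : √(2 / (t * R)) * (2 * √(2 * Δ)) = √(16 * Δ / (t * R)) := by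
      rw [show (2 : ℝ) * √(2 * Δ) = √(4 * (2 * Δ)) by
        rw [Real.sqrt_mul (by norm_num) (2 * Δ)]; norm_num,
        ← Real.sqrt_mul (by positivity)]
      congr 1
      ring
    rw [this, Real.sqrt_le_iff]
    refine ⟨by positivity, ?_⟩
    rw [div_pow, mul_pow, hτ2, div_le_div_iff₀ (by positivity) (by positivity)]
    -- The square is at most `32/(t l²)`, and `32 ≤ 6²`.
    nlinarith [mul_le_mul_of_nonneg_left g1 ht.le]
  calc _ = √(2 / (t * R)) * Δ + √(2 / (t * R)) * (2 * √(2 * Δ)) := by ring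
    _ ≤ 2 / (√t * l) + 6 / (√t * l) := add_le_add f1 f2
    _ = _ := by ring

/-- The square of the right side is at least `4(m+1/2)(n+1/2) = (2m+1)(2n+1) ≥ n+m+1`, whatever `g`
is. -/
theorem four_root_le_add {n m : ℕ} {l g : ℝ} (hg : 0 < g) (hl4 : l ^ 4 = (n : ℝ) + m + 1) :
    l ^ 2 ≤ ((m : ℝ) + 1 / 2) * g⁻¹ + ((n : ℝ) + 1 / 2) * g := by
  refine abs_le_of_sq_le_sq' ?_ (by positivity) |>.2
  have h1 : (((m : ℝ) + 1 / 2) * g⁻¹ + ((n : ℝ) + 1 / 2) * g) ^ 2 =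
      (((m : ℝ) + 1 / 2) * g⁻¹ - ((n : ℝ) + 1 / 2) * g) ^ 2 +
        (4 * n * m + 2 * n + 2 * m + 1) := by
    field_simp; ring
  have h3 : (l ^ 2) ^ 2 = (n : ℝ) + m + 1 := by rw [← hl4]; ring
  have h4 : (0 : ℝ) ≤ n := Nat.cast_nonneg n
  have h5 : (0 : ℝ) ≤ m := Nat.cast_nonneg m
  rw [h1, h3]
  linarith [sq_nonneg (((m : ℝ) + 1 / 2) * g⁻¹ - ((n : ℝ) + 1 / 2) * g), mul_nonneg h4 h5]

theorem monotoneOn_chord (ht : 0 < t) (hr : 0 < r) (hrt : r ^ 2 = 1 + t ^ 2) :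
    MonotoneOn (chord r t) (Set.Icc 0 Real.pi) := by
  refine monotoneOn_of_hasDerivWithinAt_nonneg (convex_Icc 0 Real.pi) continuous_chord.continuousOn
    (fun θ _ => (hasDerivAt_chord ht hr hrt θ).hasDerivWithinAt) fun θ hθ => ?_
  have := Real.sin_nonneg_of_mem_Icc (interior_subset hθ)
  have := chord_pos ht hr hrt θ
  positivity

/-- The trivial contribution of an interval on which the frequency varies by at most `2ε`. -/
theorem integral_inv_chord_le_of_sub_le (ht : 0 < t) (hr : 0 < r) (hrt : r ^ 2 = 1 + t ^ 2)
    {n m : ℕ} {l x y : ℝ} (hl : 0 < l) (hl4 : l ^ 4 = (n : ℝ) + m + 1)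
    (hx : 0 ≤ x) (hxy : x ≤ y) (hy : y ≤ Real.pi)
    (hdiff : (((m : ℝ) + 1 / 2) * (chord r t x)⁻¹ - ((n : ℝ) + 1 / 2) * chord r t x) -
      (((m : ℝ) + 1 / 2) * (chord r t y)⁻¹ - ((n : ℝ) + 1 / 2) * chord r t y) ≤
        2 * (√t * l)) :
    ∫ θ in x..y, (chord r t θ)⁻¹ ≤ 8 / (√t * l) := by
  have hσ := chord_pos ht hr hrt
  have hmono : chord r t x ≤ chord r t y :=
    monotoneOn_chord ht hr hrt ⟨hx, hxy.trans hy⟩ ⟨hx.trans hxy, hy⟩ hxy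
  have hlm := Real.log_le_log (hσ x) hmono
  have hinc := (mul_log_sub_log_le (by positivity) (by positivity) (hσ x) hmono).trans hdiff
  have hΔ := sub_nonneg.mpr hlm
  have hgpos : 0 < √(chord r t x * chord r t y) := Real.sqrt_pos.mpr (mul_pos (hσ x) (hσ y))
  have hRpos : 0 < r + t := by positivity
  have hgR : √(chord r t x * chord r t y) ≤ r + t := by
    rw [Real.sqrt_le_iff]
    refine ⟨hRpos.le, ?_⟩
    rw [sq]
    exact mul_le_mul (chord_le ht hr hrt x) (chord_le ht hr hrt y) (hσ y).le hRpos.le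
  have hgR' : (r + t)⁻¹ ≤ √(chord r t x * chord r t y) := by
    refine Real.le_sqrt_of_sq_le ?_
    rw [sq]
    have hinv : ∀ θ, (r + t)⁻¹ ≤ chord r t θ := fun θ => by
      rw [inv_le_iff_one_le_mul₀ hRpos, mul_comm]
      exact one_le_mul_chord ht hr hrt θ
    exact mul_le_mul (hinv x) (hinv y) (by positivity) (hσ x).le
  -- Both `g` and `g⁻¹` are at least `1/R`, for `g` the geometric mean of the two chords, and the
  -- coefficients sum to `n + m + 1`.
  have k2 : l ^ 4 / (r + t) ≤ ((m : ℝ) + 1 / 2) * (√(chord r t x * chord r t y))⁻¹ +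
      ((n : ℝ) + 1 / 2) * √(chord r t x * chord r t y) := by
    have hL : l ^ 4 = ((m : ℝ) + 1 / 2) + ((n : ℝ) + 1 / 2) := by rw [hl4]; ring
    rw [hL, div_eq_mul_inv, add_mul]
    gcongr
  have hR2 : 2 * t ≤ r + t := by
    have : t ≤ r := by nlinarith
    linarith
  exact (integral_inv_chord_le ht hr hrt hx hxy hy hlm).trans
    (length_bound ht hR2 hl hΔ rfl
      ((mul_le_mul_of_nonneg_right (four_root_le_add hgpos hl4) hΔ).trans hinc)
      ((mul_le_mul_of_nonneg_right k2 hΔ).trans hinc))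

/-- With threshold `ε = √t l`, the nonstationary pieces contribute `4/ε` and the middle interval
`8/ε`. -/
theorem norm_integral_half_le (ht : 0 < t) (hr : 0 < r) (hrt : r ^ 2 = 1 + t ^ 2) (n m : ℕ) {l : ℝ}
    (hl : 0 < l) (hl4 : l ^ 4 = (n : ℝ) + m + 1) :
    ‖∫ θ in (0 : ℝ)..Real.pi, ((chord r t θ)⁻¹ : ℝ) * phase r t n m θ‖ ≤ 12 / (√t * l) := by
  have hσ := chord_pos ht hr hrt
  have hσ0 : ∀ θ, chord r t θ ≠ 0 := fun θ => (hσ θ).ne'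
  have hσc : Continuous (chord r t) := continuous_chord
  have hε : 0 < √t * l := mul_pos (Real.sqrt_pos.mpr ht) hl
  have hq : ∀ θ, HasDerivAt
      (fun θ => ((m : ℝ) + 1 / 2) * (chord r t θ)⁻¹ - ((n : ℝ) + 1 / 2) * chord r t θ)
      (((m : ℝ) + 1 / 2) * (-(r * t * Real.sin θ / chord r t θ) / chord r t θ ^ 2) -
        ((n : ℝ) + 1 / 2) * (r * t * Real.sin θ / chord r t θ)) θ := fun θ =>
    (((hasDerivAt_chord ht hr hrt θ).inv (hσ0 θ)).const_mul _).sub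
      ((hasDerivAt_chord ht hr hrt θ).const_mul _)
  have hdc : Continuous fun θ => r * t * Real.sin θ / chord r t θ :=
    (continuous_const.mul Real.continuous_sin).div hσc hσ0
  have hq'c : Continuous fun θ =>
      ((m : ℝ) + 1 / 2) * (-(r * t * Real.sin θ / chord r t θ) / chord r t θ ^ 2) -
        ((n : ℝ) + 1 / 2) * (r * t * Real.sin θ / chord r t θ) :=
    (continuous_const.mul (hdc.neg.div (hσc.pow 2) fun θ => pow_ne_zero 2 (hσ0 θ))).sub
      (continuous_const.mul hdc)
  have hneg : ∀ θ ∈ Set.Icc 0 Real.pi,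
      ((m : ℝ) + 1 / 2) * (-(r * t * Real.sin θ / chord r t θ) / chord r t θ ^ 2) -
        ((n : ℝ) + 1 / 2) * (r * t * Real.sin θ / chord r t θ) ≤ 0 := fun θ hθ => by
    have h1 := Real.sin_nonneg_of_mem_Icc hθ
    have h2 := hσ θ
    rw [neg_div, mul_neg, sub_nonpos]
    exact (neg_nonpos.mpr (by positivity)).trans (by positivity)
  obtain ⟨x, y, hx, hxy, hy, hdiff, hbound⟩ := exists_norm_integral_le_of_hasDerivAt_phase
    Real.pi_pos.le hε (fun θ => (inv_pos.mpr (hσ θ)).le) (hasDerivAt_phase ht hr hrt n m)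
    (norm_phase ht hr hrt n m) hq (hσc.inv₀ hσ0) hq'c hneg
  have hlen := integral_inv_chord_le_of_sub_le ht hr hrt hl hl4 hx hxy hy hdiff
  have : 12 / (√t * l) = 4 / (√t * l) + 8 / (√t * l) := by ring
  linarith

/-- Reflection `θ ↦ -θ` conjugates the integrand, so the two half circles contribute equally in
norm. -/
theorem norm_integral_full_le (ht : 0 < t) (hr : 0 < r) (hrt : r ^ 2 = 1 + t ^ 2) (n m : ℕ) {l : ℝ}
    (hl : 0 < l) (hl4 : l ^ 4 = (n : ℝ) + m + 1) :
    ‖∫ θ in (-Real.pi)..Real.pi, ((chord r t θ)⁻¹ : ℝ) * phase r t n m θ‖ ≤ 24 / (√t * l) := by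
  have hc : Continuous fun θ => (((chord r t θ)⁻¹ : ℝ) : ℂ) * phase r t n m θ :=
    (Complex.continuous_ofReal.comp (continuous_chord.inv₀
      fun θ => (chord_pos ht hr hrt θ).ne')).mul (continuous_phase ht hr hrt n m)
  have hhalf := norm_integral_half_le ht hr hrt n m hl hl4
  have hneg : ∫ θ in (-Real.pi)..0, (((chord r t θ)⁻¹ : ℝ) : ℂ) * phase r t n m θ =
      conj (∫ θ in (0 : ℝ)..Real.pi, (((chord r t θ)⁻¹ : ℝ) : ℂ) * phase r t n m θ) := by
    rw [← intervalIntegral.intervalIntegral_conj]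
    have := intervalIntegral.integral_comp_neg (a := 0) (b := Real.pi)
      (fun θ => (((chord r t θ)⁻¹ : ℝ) : ℂ) * phase r t n m θ)
    rw [neg_zero] at this
    rw [← this]
    refine intervalIntegral.integral_congr fun θ _ => ?_
    simp only [chord_neg, phase_neg, map_mul, Complex.conj_ofReal]
  rw [← intervalIntegral.integral_add_adjacent_intervals (hc.intervalIntegrable (-Real.pi) 0)
    (hc.intervalIntegrable 0 Real.pi), hneg]
  refine (norm_add_le _ _).trans ?_
  rw [RCLike.norm_conj]
  have : 24 / (√t * l) = 12 / (√t * l) + 12 / (√t * l) := by ring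
  linarith

end Phase

theorem fourier_two_pi_coe (k : ℤ) (x : ℝ) :
    (fourier k (x : Circ) : ℂ) = Complex.exp (k * x * Complex.I) := by
  rw [fourier_coe_apply]
  congr 1
  have : (Real.pi : ℂ) ≠ 0 := by exact_mod_cast Real.pi_ne_zero
  push_cast
  field_simp

/-- The matrix entries of the evolution as an oscillatory integral, up to a phase. -/
theorem norm_basisSolution_apply {r t : ℝ} (ht : 0 < t) (hr : 0 < r) (hrt : r ^ 2 = 1 + t ^ 2)
    (n m : ℕ) : ‖basisSolution m t n‖ = (2 * Real.pi)⁻¹ *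
      ‖∫ θ in (-Real.pi)..Real.pi, ((chord r t θ)⁻¹ : ℝ) * phase r t n m θ‖ := by
  have hr0 : (r : ℂ) ≠ 0 := Complex.ofReal_ne_zero.mpr hr.ne'
  have hrt' : (r : ℂ) ^ 2 = 1 + t ^ 2 := by exact_mod_cast hrt
  -- Rotating by `z = i u e^{iθ}` turns `1 + it(1+z)` into `u (r - t e^{iθ})`, whose modulus is the
  -- chord and is even in `θ`.
  set u : ℂ := (1 + Complex.I * t) / r with hu
  have hun : ‖u‖ = 1 := by
    have h1 : ‖(1 + Complex.I * t : ℂ)‖ = r := by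
      refine (pow_left_inj₀ (norm_nonneg _) hr.le two_ne_zero).mp ?_
      rw [Complex.sq_norm, hrt]
      simp [Complex.normSq_apply]
      ring
    rw [hu, norm_div, h1, Complex.norm_real, Real.norm_of_nonneg hr.le, div_self hr.ne']
  have hu0 : u ≠ 0 := norm_ne_zero_iff.mp (by rw [hun]; exact one_ne_zero)
  set φ : ℝ := Complex.arg (Complex.I * u)
  have hφ : Complex.exp (φ * Complex.I) = Complex.I * u := by
    have := Complex.norm_mul_exp_arg_mul_I (Complex.I * u)
    rwa [norm_mul, Complex.norm_I, hun, one_mul, Complex.ofReal_one, one_mul] at this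
  have hshift := intervalIntegral.integral_comp_add_left (a := -Real.pi) (b := Real.pi)
    (fun x : ℝ => (fourier (-(n : ℤ)) * wave m t : C(Circ, ℂ)) (x : Circ)) φ
  rw [basisSolution, hardyCoeff_apply, circMean_eq_intervalIntegral _ (φ + -Real.pi),
    show φ + -Real.pi + 2 * Real.pi = φ + Real.pi by ring, ← hshift]
  have hpt : ∀ θ : ℝ, (fourier (-(n : ℤ)) * wave m t : C(Circ, ℂ)) ((φ + θ : ℝ) : Circ) =
      (Complex.exp (-(n * φ) * Complex.I) * (Complex.I / u) ^ m * u⁻¹) *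
        (((chord r t θ)⁻¹ : ℝ) * phase r t n m θ) := by
    intro θ
    have hσ : (chord r t θ : ℂ) ≠ 0 := Complex.ofReal_ne_zero.mpr (chord_pos ht hr hrt θ).ne'
    have hX := sub_exp_ne_zero ht hr hrt θ
    have hz : (fourier 1 ((φ + θ : ℝ) : Circ) : ℂ) =
        Complex.I * u * Complex.exp (θ * Complex.I) := by
      rw [fourier_two_pi_coe, ← hφ, ← Complex.exp_add]
      congr 1
      push_cast
      ring
    have hzn : (fourier (-(n : ℤ)) ((φ + θ : ℝ) : Circ) : ℂ) =
        Complex.exp (-(n * φ) * Complex.I) * Complex.exp (-(n * θ) * Complex.I) := by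
      rw [fourier_two_pi_coe, ← Complex.exp_add]
      congr 1
      push_cast
      ring
    have hur : u * r = 1 + Complex.I * t := by rw [hu]; field_simp
    have hur2 : u * (1 - Complex.I * t) = r := by
      rw [hu]
      field_simp
      linear_combination -hrt' - (t : ℂ) ^ 2 * Complex.I_sq
    have hD : denom t ((φ + θ : ℝ) : Circ) = u * (r - t * Complex.exp (θ * Complex.I)) := by
      simp only [denom, onePlus, ContinuousMap.add_apply, ContinuousMap.smul_apply,
        ContinuousMap.one_apply, smul_eq_mul, hz]
      linear_combination (t : ℂ) * u * Complex.exp (θ * Complex.I) * Complex.I_sq - hur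
    have hN : onePlus ((φ + θ : ℝ) : Circ) - denom t ((φ + θ : ℝ) : Circ) =
        Complex.I * (r * Complex.exp (θ * Complex.I) - t) := by
      rw [hD]
      simp only [onePlus, ContinuousMap.add_apply, ContinuousMap.one_apply, hz]
      linear_combination -hur + Complex.I * Complex.exp (θ * Complex.I) * hur2 +
        u * t * Complex.exp (θ * Complex.I) * Complex.I_sq
    have hBl : onePlus ((φ + θ : ℝ) : Circ) * (denom t ((φ + θ : ℝ) : Circ))⁻¹ - 1 =
        Complex.I / u * ((r * Complex.exp (θ * Complex.I) - t) /
          (r - t * Complex.exp (θ * Complex.I))) := by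
      have h0 := denom_apply_ne_zero t ((φ + θ : ℝ) : Circ)
      have : onePlus ((φ + θ : ℝ) : Circ) * (denom t ((φ + θ : ℝ) : Circ))⁻¹ - 1 =
          (onePlus ((φ + θ : ℝ) : Circ) - denom t ((φ + θ : ℝ) : Circ)) /
            denom t ((φ + θ : ℝ) : Circ) := by field_simp
      rw [this, hN, hD]
      field_simp
    simp only [wave, ContinuousMap.mul_apply, ContinuousMap.pow_apply, ContinuousMap.sub_apply,
      ContinuousMap.one_apply, denomInv_apply]
    rw [hBl, hzn, hD, phase, mul_pow]
    push_cast
    field_simp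
  have hcn : ‖Complex.exp (-(n * φ) * Complex.I) * (Complex.I / u) ^ m * u⁻¹‖ = 1 := by
    have := Complex.norm_exp_ofReal_mul_I (-(n * φ))
    push_cast at this
    rw [norm_mul, norm_mul, this, norm_pow, norm_div, norm_inv, hun, Complex.norm_I]
    simp
  simp only [hpt]
  rw [intervalIntegral.integral_const_mul, norm_smul, norm_mul, hcn, one_mul, one_div,
    Real.norm_of_nonneg (by positivity)]

/-- The dispersive estimate for the explicit solutions. -/
theorem norm_basisSolution_apply_le {t : ℝ} (ht : 0 < t) (n m : ℕ) :
    ‖basisSolution m t n‖ ≤ 4 / (t ^ (1 / 2 : ℝ) * ((n : ℝ) + (m : ℝ) + 1) ^ (1 / 4 : ℝ)) := by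
  have hL : (0 : ℝ) < (n : ℝ) + m + 1 := by positivity
  set l : ℝ := ((n : ℝ) + m + 1) ^ (1 / 4 : ℝ) with hl
  have hlpos : 0 < l := Real.rpow_pos_of_pos hL _
  have hl4 : l ^ 4 = (n : ℝ) + m + 1 := by
    rw [hl, ← Real.rpow_natCast, ← Real.rpow_mul hL.le]
    norm_num
  have hr : 0 < √(1 + t ^ 2) := Real.sqrt_pos.mpr (by positivity)
  have hrt : √(1 + t ^ 2) ^ 2 = 1 + t ^ 2 := Real.sq_sqrt (by positivity)
  rw [norm_basisSolution_apply ht hr hrt, ← Real.sqrt_eq_rpow]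
  have h := norm_integral_full_le ht hr hrt n m hlpos hl4
  have hpos : 0 < √t * l := mul_pos (Real.sqrt_pos.mpr ht) hlpos
  calc _ ≤ (2 * Real.pi)⁻¹ * (24 / (√t * l)) :=
        mul_le_mul_of_nonneg_left h (by positivity)
    _ = (12 / Real.pi) / (√t * l) := by field_simp; norm_num
    _ ≤ 4 / (√t * l) := by
        gcongr
        rw [div_le_iff₀ Real.pi_pos]
        linarith [Real.pi_gt_three]

theorem four_le_two_mul_rpow : (4 : ℝ) ≤ 2 * (42 : ℝ) ^ (1 / 4 : ℝ) := by
  have h : ((2 : ℝ) ^ (4 : ℝ)) ^ (1 / 4 : ℝ) = 2 := by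
    rw [← Real.rpow_mul (by norm_num)]
    norm_num
  have : (2 : ℝ) ≤ (42 : ℝ) ^ (1 / 4 : ℝ) := by
    rw [← h]
    exact Real.rpow_le_rpow (by positivity) (by norm_num) (by norm_num)
  linarith

end DiscreteLaguerre

end

theorem theorem3 :
    (∃! U : ℝ → DiscreteLaguerre.EllTwo →L[ℂ] DiscreteLaguerre.EllTwo,
      DiscreteLaguerre.IsEvolutionGroup DiscreteLaguerre.H0 U) ∧
    ∃ C : ℝ, C ≤ 2 * (42 : ℝ) ^ (1 / 4 : ℝ) ∧
      ∀ U : ℝ → DiscreteLaguerre.EllTwo →L[ℂ] DiscreteLaguerre.EllTwo,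
        DiscreteLaguerre.IsEvolutionGroup DiscreteLaguerre.H0 U →
        ∀ (t : ℝ), 0 < t → ∀ n m : ℕ,
          ‖DiscreteLaguerre.kernel (U t) n m‖ ≤
            C / (t ^ (1 / 2 : ℝ) * ((n : ℝ) + (m : ℝ) + 1) ^ (1 / 4 : ℝ)) := by
  -- The constant `4` bounds `24/(2π) = 12/π`, using only `π > 3`.
  refine ⟨DiscreteLaguerre.existsUnique_isEvolutionGroup
    DiscreteLaguerre.isSolution_basisSolution DiscreteLaguerre.basisSolution_zero, 4,
    DiscreteLaguerre.four_le_two_mul_rpow, fun U hU t ht n m => ?_⟩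
  rw [DiscreteLaguerre.kernel, hU.apply_delta (DiscreteLaguerre.isSolution_basisSolution m)
    (DiscreteLaguerre.basisSolution_zero m), DiscreteLaguerre.inner_delta_left]
  exact DiscreteLaguerre.norm_basisSolution_apply_le ht n m
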